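/- Let $M$ be a (Hausdorff, second countable) smooth manifold and let $\Theta\in C^\infty(M,\bigwedge^2TM)$ be a smooth bivector field. For $x\in M$ let $\Theta_x:T_x^*M\to T_xM$ be the homomorphism defined by $w(\Theta_x(v))=\Theta(x)(v\wedge w)$, put $V_x=\Theta_x(T_x^*M)\subset T_xM$, and let $\widehat\varphi'_x$ be the (well-defined, alternating, nondegenerate) bilinear form on $V_x$ given by $\widehat\varphi'_x(\Theta_x(v),u)=v(u)$ for $v\in T_x^*M$, $u\in V_x$. Let $\widehat\Theta:T^*M\to TM$ be the homomorphism of vector bundles with $\widehat\Theta(x)=\Theta_x$. Call $x$ nonsingular if $\dim V_y$ is constant for $y$ in a neighborhood of $x$. Call $\Theta$ Poisson if the bracket $\{f,g\}=\Theta(df\wedge dg)$ satisfies the Jacobi identity $\{f_1,\{f_2,f_3\}\}+\{f_2,\{f_3,f_1\}\}+\{f_3,\{f_1,f_2\}\}=0$ for all $f_1,f_2,f_3\in C^\infty(M)$ (equivalently, if the Schouten--Nijenhuis bracket $[\Theta,\Theta]$ vanishes). Then $\Theta$ is Poisson if and only if the following two conditions hold: 1. The subsheaf $\widehat\Theta(T^*M)\subset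 TM$, whose sections over an open set $U$ are the vector fields on $U$ that are locally of the form $\widehat\Theta(\alpha)$ with $\alpha$ a smooth $1$-form, is closed under the Lie bracket. 2. For every leaf $\mathbb L$ of the restriction of the (integrable) distribution $x\mapsto V_x$ to the open set of nonsingular points, the two-form $\widehat\varphi'_{\mathbb L}$ on $\mathbb L$ defined by $\widehat\varphi'_{\mathbb L}(x)(v_1,v_2)=\widehat\varphi'_x(v_1,v_2)$ for $x\in\mathbb L$ and $v_1,v_2\in T_x\mathbb L=V_x$ is a symplectic form on $\mathbb L$, i.e. it is smooth, nondegenerate and closed. -/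

import Mathlib

open scoped Manifold ContDiff Topology
open Bundle

set_option maxSynthPendingDepth 3
set_option synthInstance.maxHeartbeats 200000

noncomputable section

namespace PoissonGeometry

variable {E : Type*} [NormedAddCommGroup E] [NormedSpace ℝ E] [FiniteDimensional ℝ E]
  {M : Type*} [TopologicalSpace M] [ChartedSpace E M]

/-- The tangent space of `M` at `x`. -/
abbrev Tangent (E : Type*) [NormedAddCommGroup E] [NormedSpace ℝ E]
    {M : Type*} [TopologicalSpace M] [ChartedSpace E M] (x : M) : Type _ :=
  TangentSpace 𝓘(ℝ, E) x

/-- The cotangent space of `M` at `x`. -/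
abbrev Cotangent (E : Type*) [NormedAddCommGroup E] [NormedSpace ℝ E]
    {M : Type*} [TopologicalSpace M] [ChartedSpace E M] (x : M) : Type _ :=
  Tangent E x →L[ℝ] ℝ

instance (x : M) : FiniteDimensional ℝ (Tangent E x) :=
  inferInstanceAs (FiniteDimensional ℝ E)

instance (x : M) : T2Space (Tangent E x) := inferInstanceAs (T2Space E)

/-- The `1`-form `α` is smooth on the set `U`, as a section of the cotangent bundle. -/
def SmoothOneFormOn [IsManifold 𝓘(ℝ, E) ∞ M] (α : ∀ x : M, Cotangent E x) (U : Set M) : Prop :=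
  ContMDiffOn 𝓘(ℝ, E) (𝓘(ℝ, E).prod 𝓘(ℝ, E →L[ℝ] ℝ)) ∞
    (fun x ↦ TotalSpace.mk' (E →L[ℝ] ℝ) (E := fun y : M ↦ Cotangent E y) x (α x)) U

variable (E M) in
/-- A smooth bivector field on `M`: a smooth section of `⋀² TM`, that is, a smooth family of
alternating bilinear forms `(v, w) ↦ Θ(x)(v ∧ w)` on the cotangent spaces of `M`. -/
structure Bivector [IsManifold 𝓘(ℝ, E) ∞ M] where
  /-- the pairing `Θ(x)(v ∧ w)` -/
  toFun : ∀ x : M, Cotangent E x →L[ℝ] Cotangent E x →L[ℝ] ℝ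
  alternating : ∀ (x : M) (v : Cotangent E x), toFun x v v = 0
  smooth : ContMDiff 𝓘(ℝ, E)
    (𝓘(ℝ, E).prod 𝓘(ℝ, (E →L[ℝ] ℝ) →L[ℝ] (E →L[ℝ] ℝ) →L[ℝ] ℝ)) ∞
    (fun x ↦ TotalSpace.mk' ((E →L[ℝ] ℝ) →L[ℝ] (E →L[ℝ] ℝ) →L[ℝ] ℝ)
      (E := fun y : M ↦ Cotangent E y →L[ℝ] Cotangent E y →L[ℝ] ℝ) x (toFun x))

namespace Bivector

variable [IsManifold 𝓘(ℝ, E) ∞ M] (Θ : Bivector E M)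

/-- The bracket `{f, g} = Θ(df ∧ dg)` of two functions. -/
def bracket (f g : M → ℝ) (x : M) : ℝ :=
  Θ.toFun x (mvfderiv 𝓘(ℝ, E) f x) (mvfderiv 𝓘(ℝ, E) g x)

/-- `Θ` is a Poisson structure: its bracket of smooth functions satisfies the Jacobi identity. -/
def IsPoisson : Prop :=
  ∀ f₁ f₂ f₃ : M → ℝ,
    ContMDiff 𝓘(ℝ, E) 𝓘(ℝ, ℝ) ∞ f₁ → ContMDiff 𝓘(ℝ, E) 𝓘(ℝ, ℝ) ∞ f₂ →
    ContMDiff 𝓘(ℝ, E) 𝓘(ℝ, ℝ) ∞ f₃ →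
    ∀ x, Θ.bracket f₁ (Θ.bracket f₂ f₃) x + Θ.bracket f₂ (Θ.bracket f₃ f₁) x +
      Θ.bracket f₃ (Θ.bracket f₁ f₂) x = 0

/-- The homomorphism `Θ_x : T*_x M → T_x M` determined by `w (Θ_x v) = Θ(x)(v ∧ w)`. -/
def sharp (x : M) : Cotangent E x →ₗ[ℝ] Tangent E x where
  toFun v := (Module.evalEquiv ℝ (Tangent E x)).symm
    ((Θ.toFun x v).toLinearMap ∘ₗ LinearMap.toContinuousLinearMap.toLinearMap)
  map_add' v w := by
    rw [← map_add]; congr 1; ext u; simp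
  map_smul' c v := by
    rw [← map_smul]; congr 1; ext u; simp

/-- The defining equation of `Θ_x`. -/
theorem apply_sharp (x : M) (v w : Cotangent E x) : w (Θ.sharp x v) = Θ.toFun x v w := by
  have h := Module.apply_evalEquiv_symm_apply ℝ (Tangent E x) w.toLinearMap
    ((Θ.toFun x v).toLinearMap ∘ₗ LinearMap.toContinuousLinearMap.toLinearMap)
  refine h.trans ?_
  simp only [LinearMap.comp_apply]
  exact congrArg (Θ.toFun x v) (by ext; rfl)

/-- `Θ` is skew-symmetric: `w (Θ_x v) + v (Θ_x w) = 0`. -/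
theorem apply_sharp_add (x : M) (v w : Cotangent E x) :
    w (Θ.sharp x v) + v (Θ.sharp x w) = 0 := by
  have h := Θ.alternating x (v + w)
  simp only [map_add, add_apply, Θ.alternating, zero_add, add_zero] at h
  rw [apply_sharp, apply_sharp, add_comm]
  linarith

/-- The image `V_x = Θ_x(T*_x M)`, a subspace of `T_x M`. -/
def image (x : M) : Submodule ℝ (Tangent E x) := LinearMap.range (Θ.sharp x)

/-- The dual `φ : T*_x M → V_x*` of the inclusion of `V_x` into `T_x M`. -/
def restrict (x : M) : Cotangent E x →ₗ[ℝ] Module.Dual ℝ (Θ.image x) where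
  toFun v := v.toLinearMap ∘ₗ (Θ.image x).subtype
  map_add' _ _ := rfl
  map_smul' _ _ := rfl

theorem ker_sharp_le_ker_restrict (x : M) :
    LinearMap.ker (Θ.sharp x) ≤ LinearMap.ker (Θ.restrict x) := by
  intro v hv
  rw [LinearMap.mem_ker] at hv ⊢
  ext ⟨u, hu⟩
  obtain ⟨w, rfl⟩ := hu
  have h := Θ.apply_sharp_add x v w
  rw [hv, map_zero, zero_add] at h
  exact h

/-- The bilinear form on `V_x` given by the homomorphism `V_x = T*_x M / ker Θ_x → V_x*` to which
the restriction map `T*_x M → V_x*` descends. -/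
def imageForm (x : M) : Θ.image x →ₗ[ℝ] Θ.image x →ₗ[ℝ] ℝ :=
  (LinearMap.ker (Θ.sharp x)).liftQ (Θ.restrict x) (Θ.ker_sharp_le_ker_restrict x) ∘ₗ
    (LinearMap.quotKerEquivRange (Θ.sharp x)).symm.toLinearMap

/-- The form on `V_x` sends `(Θ_x v, u)` to `v u`. -/
theorem imageForm_sharp (x : M) (v : Cotangent E x) (u : Θ.image x) :
    Θ.imageForm x ⟨Θ.sharp x v, LinearMap.mem_range_self _ v⟩ u = v u := by
  have h : (LinearMap.quotKerEquivRange (Θ.sharp x)).symm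
      ⟨Θ.sharp x v, LinearMap.mem_range_self _ v⟩ = Submodule.Quotient.mk v := by
    rw [LinearEquiv.symm_apply_eq]
    rfl
  have h2 : Θ.imageForm x ⟨Θ.sharp x v, LinearMap.mem_range_self _ v⟩ =
      (LinearMap.ker (Θ.sharp x)).liftQ (Θ.restrict x) (Θ.ker_sharp_le_ker_restrict x)
        ((LinearMap.quotKerEquivRange (Θ.sharp x)).symm
          ⟨Θ.sharp x v, LinearMap.mem_range_self _ v⟩) := rfl
  rw [h2, h]
  rfl

/-- The vector field `X` is over `U` a section of the image subsheaf `Θ(T*M)` of `TM`: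
near each point of `U` it is the image of a smooth `1`-form. -/
def IsImageSection (U : Set M) (X : ∀ x : M, Tangent E x) : Prop :=
  ∀ x ∈ U, ∃ W : Set M, IsOpen W ∧ x ∈ W ∧ W ⊆ U ∧
    ∃ α : ∀ y : M, Cotangent E y, SmoothOneFormOn α W ∧ ∀ y ∈ W, X y = Θ.sharp y (α y)

/-- The image subsheaf `Θ(T*M)` of `TM` is closed under the Lie bracket. -/
def ImageClosedUnderLieBracket : Prop :=
  ∀ U : Set M, IsOpen U → ∀ X Y : (∀ x : M, Tangent E x),
    Θ.IsImageSection U X → Θ.IsImageSection U Y →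
    Θ.IsImageSection U (fun x ↦ VectorField.mlieBracket 𝓘(ℝ, E) X Y x)

/-- The nonsingular locus of the distribution `x ↦ V_x`: the points near which the dimension
of `V_x` is constant. -/
def nonsingularLocus : Set M :=
  {x | ∀ᶠ y in 𝓝 x, Module.finrank ℝ (Θ.image y) = Module.finrank ℝ (Θ.image x)}

/-- `x` and `y` lie on a common smooth curve in the nonsingular locus that is everywhere tangent
to the distribution. -/
def OnTangentCurve (x y : M) : Prop :=
  ∃ γ : ℝ → M, ContMDiff 𝓘(ℝ, ℝ) 𝓘(ℝ, E) ∞ γ ∧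
    (∀ t, γ t ∈ Θ.nonsingularLocus) ∧
    (∀ t, LinearMap.range (mfderiv 𝓘(ℝ, ℝ) 𝓘(ℝ, E) γ t).toLinearMap ≤ Θ.image (γ t)) ∧
    x ∈ Set.range γ ∧ y ∈ Set.range γ

/-- The leaf through `x` of the nonsingular locus: all points that can be reached from `x` by
finitely many smooth curves in the nonsingular locus tangent to the distribution. -/
def leafThrough (x : M) : Set M := {y | Relation.ReflTransGen Θ.OnTangentCurve x y}

/-- `L` is a leaf of the nonsingular locus. -/
def IsLeaf (L : Set M) : Prop := ∃ x ∈ Θ.nonsingularLocus, L = Θ.leafThrough x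

/-- `c : U → L` is a smooth parametrization of an open piece of the leaf `L`, for the
(immersed) manifold structure of `L`: a smooth injective immersion into `M`, defined on an open
subset `U` of some `ℝᵏ`, with values in `L`, whose tangent spaces are the spaces `V_y`.
For an integrable distribution the inverses of these maps are the charts of `L`. -/
structure IsLeafParametrization (L : Set M) {k : ℕ} (U : Set (EuclideanSpace ℝ (Fin k)))
    (c : EuclideanSpace ℝ (Fin k) → M) : Prop where
  isOpen : IsOpen U
  smooth : ContMDiffOn 𝓘(ℝ, EuclideanSpace ℝ (Fin k)) 𝓘(ℝ, E) ∞ c U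
  injOn : Set.InjOn c U
  mapsTo : Set.MapsTo c U L
  immersion : ∀ u ∈ U,
    Function.Injective (mfderiv 𝓘(ℝ, EuclideanSpace ℝ (Fin k)) 𝓘(ℝ, E) c u)
  tangent : ∀ u ∈ U,
    LinearMap.range (mfderiv 𝓘(ℝ, EuclideanSpace ℝ (Fin k)) 𝓘(ℝ, E) c u).toLinearMap =
      Θ.image (c u)

/-- The differential of a leaf parametrization at `u`, as a map to `V_{c u} = T_{c u} L`. -/
def IsLeafParametrization.differential {Θ : Bivector E M} {L : Set M} {k : ℕ}
    {U : Set (EuclideanSpace ℝ (Fin k))} {c : EuclideanSpace ℝ (Fin k) → M}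
    (hc : Θ.IsLeafParametrization L U c) (u : U) :
    EuclideanSpace ℝ (Fin k) →ₗ[ℝ] Θ.image (c u) :=
  LinearMap.codRestrict (Θ.image (c u))
    (mfderiv 𝓘(ℝ, EuclideanSpace ℝ (Fin k)) 𝓘(ℝ, E) c (u : EuclideanSpace ℝ (Fin k))).toLinearMap
    (fun ξ ↦ by rw [← hc.tangent u u.2]; exact LinearMap.mem_range_self _ ξ)

/-- The two-form on the leaf `L` given at `y ∈ L` by the form on `V_y = T_y L` is symplectic:
it is alternating and nondegenerate at each point, and in each parametrization of `L` it is a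
smooth closed differential form. -/
def LeafFormIsSymplectic (L : Set M) : Prop :=
  (∀ y ∈ L, (Θ.imageForm y).IsAlt ∧ (Θ.imageForm y).Nondegenerate) ∧
  ∀ (k : ℕ) (U : Set (EuclideanSpace ℝ (Fin k))) (c : EuclideanSpace ℝ (Fin k) → M)
    (hc : Θ.IsLeafParametrization L U c),
    ∃ σ : EuclideanSpace ℝ (Fin k) → EuclideanSpace ℝ (Fin k) [⋀^Fin 2]→L[ℝ] ℝ,
      ContDiffOn ℝ ∞ σ U ∧
      (∀ (u : U) (ξ η : EuclideanSpace ℝ (Fin k)),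
        σ u ![ξ, η] = Θ.imageForm (c u) (hc.differential u ξ) (hc.differential u η)) ∧
      ∀ u ∈ U, extDeriv σ u = 0

end Bivector

end PoissonGeometry

end

/-! In a chart, `Θ` becomes a smooth family `Q z` of skew maps from covectors to vectors, and both
sides of the equivalence are governed by one expression, the `jacobiator` J(a, b, c), the cyclic sum
of c(DQ(Qa)b). When the iterated brackets of three functions are expanded, skewness of `Q` and
symmetry of Hessians cancel all second derivatives, so `Θ` is Poisson exactly when J vanishes in
every chart (`isPoisson_iff_jacobiator`).

Suppose J = 0. Then the Lie bracket of Qα and Qβ is Q applied to an explicit smooth one-form, which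
gives closure of the image. Along a leaf, Cartan's formula identifies the exterior derivative of the
leaf form on the vectors Qa, Qb, Qc with J(a, b, c) (`extDeriv_eq_jacobiator`). These vectors span
the tangent space of the leaf, so the form is closed. Nondegeneracy and the alternating property are
pointwise linear algebra.

Conversely, closure under the bracket makes the distribution involutive. Near a nonsingular point
the rank is constant, so Frobenius (`exists_integral_immersion`) gives an immersed piece of leaf
through the point, and closedness of its form forces J = 0 there. The rank is lower semicontinuous
and bounded, so nonsingular points are dense; J is continuous, hence zero everywhere.

Frobenius is reduced to the total differential equation Dc = B ∘ c (`exists_hasFDerivAt_eq_comp`).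
This is solved along rays by Picard–Lindelöf, and Grönwall's inequality shows that the endpoints
depend differentiably on the ray, with the required derivative. -/

noncomputable section

namespace PoissonGeometry

/-! ### Total differential equations and their integrability. -/

section Frobenius

open Metric Set

/-- Near a point of smoothness, a map, its derivative and its second order Taylor remainder are
bounded on a closed ball. -/
theorem exists_taylor_bounds {E G : Type*} [NormedAddCommGroup E] [NormedSpace ℝ E]
    [NormedAddCommGroup G] [NormedSpace ℝ G] {S : Set E} (hS : IsOpen S) {B : E → G}
    (hB : ContDiffOn ℝ ∞ B S) {x₀ : E} (hx₀ : x₀ ∈ S) :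
    ∃ a > 0, ∃ C > 0, closedBall x₀ a ⊆ S ∧ (∀ x ∈ closedBall x₀ a, ‖B x‖ ≤ C) ∧
      (∀ x ∈ closedBall x₀ a, ‖fderiv ℝ B x‖ ≤ C) ∧
      ∀ x ∈ closedBall x₀ a, ∀ y ∈ closedBall x₀ a,
        ‖B y - B x - fderiv ℝ B x (y - x)‖ ≤ C * ‖y - x‖ ^ 2 := by
  have hd : ContDiffOn ℝ ∞ (fderiv ℝ B) S := hB.fderiv_of_isOpen hS (by simp)
  have hat : ContDiffAt ℝ 1 (fderiv ℝ B) x₀ :=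
    (hd.contDiffAt (hS.mem_nhds hx₀)).of_le (by exact_mod_cast le_top)
  obtain ⟨K, T, hT, hK⟩ := hat.exists_lipschitzOnWith
  have h1 : ∀ᶠ x in 𝓝 x₀, ‖B x‖ < ‖B x₀‖ + 1 :=
    (hB.contDiffAt (hS.mem_nhds hx₀)).continuousAt.norm.eventually_lt_const (by linarith)
  have h2 : ∀ᶠ x in 𝓝 x₀, ‖fderiv ℝ B x‖ < ‖fderiv ℝ B x₀‖ + 1 :=
    hat.continuousAt.norm.eventually_lt_const (by linarith)
  obtain ⟨a, ha, hsub⟩ := nhds_basis_closedBall.eventually_iff.1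
    (((hS.eventually_mem hx₀).and (Filter.eventually_mem_set.2 hT)).and (h1.and h2))
  refine ⟨a, ha, ‖B x₀‖ + ‖fderiv ℝ B x₀‖ + K + 1, by positivity, fun x hx ↦ (hsub hx).1.1,
    fun x hx ↦ ?_, fun x hx ↦ ?_, fun x hx y hy ↦ ?_⟩
  · have := (hsub hx).2.1
    have := norm_nonneg (fderiv ℝ B x₀)
    have := K.2
    linarith [NNReal.coe_nonneg K]
  · have := (hsub hx).2.2
    have := norm_nonneg (B x₀)
    linarith [NNReal.coe_nonneg K]
  · have hseg : segment ℝ x y ⊆ closedBall x₀ a := (convex_closedBall x₀ a).segment_subset hx hy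
    -- Mean value inequality for `B` minus its linearization at `x`: on the segment the derivative
    -- of the difference is at most K‖y - x‖, by the Lipschitz bound on the derivative of `B`.
    have := Convex.norm_image_sub_le_of_norm_fderiv_le' (𝕜 := ℝ) (f := B) (C := K * ‖y - x‖)
      (s := segment ℝ x y) (x := x) (y := y) (φ := fderiv ℝ B x)
      (fun z hz ↦ (hB.contDiffAt (hS.mem_nhds (hsub (hseg hz)).1.1)).differentiableAt (by simp))
      (fun z hz ↦ by
        refine (hK.norm_sub_le (hsub (hseg hz)).1.2 (hsub hx).1.2).trans ?_
        gcongr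
        obtain ⟨t, ht, rfl⟩ := (segment_eq_image' ℝ x y ▸ hz :)
        rw [add_sub_cancel_left, norm_smul, Real.norm_of_nonneg ht.1]
        exact mul_le_of_le_one_left (norm_nonneg _) ht.2)
      (convex_segment x y) (left_mem_segment ℝ x y) (right_mem_segment ℝ x y)
    refine this.trans ?_
    rw [mul_assoc, ← sq]
    gcongr
    linarith [norm_nonneg (B x₀), norm_nonneg (fderiv ℝ B x₀)]

variable {E : Type*} [NormedAddCommGroup E] [NormedSpace ℝ E]
  {F : Type*} [NormedAddCommGroup F] [NormedSpace ℝ F]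

/-- A solution of `Dc = B ∘ c` is as smooth as `B`. -/
theorem contDiffOn_of_hasFDerivAt_comp {B : E → F →L[ℝ] E} {S : Set E} (hB : ContDiffOn ℝ ∞ B S)
    {c : F → E} {U : Set F} (hU : IsOpen U) (hcS : MapsTo c U S)
    (hc : ∀ s ∈ U, HasFDerivAt c (B (c s)) s) : ContDiffOn ℝ ∞ c U := by
  rw [contDiffOn_infty]
  have hd : DifferentiableOn ℝ c U := fun s hs ↦
    (hc s hs).differentiableAt.differentiableWithinAt
  intro n
  induction n with
  | zero => exact contDiffOn_zero.2 hd.continuousOn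
  | succ n ih =>
    push_cast
    rw [contDiffOn_succ_iff_fderiv_of_isOpen hU]
    refine ⟨hd, fun h ↦ by simp at h, ?_⟩
    -- Bootstrapping: if `c` is of class C^n, then so is its derivative `B ∘ c`.
    refine ((hB.of_le (by exact_mod_cast le_top)).comp ih hcS).congr fun s hs ↦ ?_
    exact (hc s hs).fderiv

variable [CompleteSpace E]

/-- An autonomous differential equation on a ball whose vector field is small compared with the
radius has a solution on `[0, 1]` that stays in the ball. -/
theorem exists_solution_Icc_zero_one {f : E → E} {x₀ : E} {a : ℝ} {K : NNReal} (ha : 0 ≤ a)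
    (hb : ∀ x ∈ closedBall x₀ a, ‖f x‖ ≤ a) (hl : LipschitzOnWith K f (closedBall x₀ a)) :
    ∃ α : ℝ → E, α 0 = x₀ ∧ (∀ t, α t ∈ closedBall x₀ a) ∧
      ∀ t ∈ Icc (0 : ℝ) 1, HasDerivWithinAt α (f (α t)) (Icc 0 1) t := by
  lift a to NNReal using ha
  have hf : IsPicardLindelof (fun _ ↦ f) (⟨0, by simp⟩ : Icc (0 : ℝ) 1) x₀ a 0 a K :=
    .of_time_independent hb hl (by simp)
  have hx : x₀ ∈ closedBall x₀ ((0 : NNReal) : ℝ) := mem_closedBall_self le_rfl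
  -- The Picard fixed point itself is kept, because membership in the function space confines the
  -- curve to the closed ball.
  obtain ⟨α, hα⟩ := ODE.FunSpace.exists_isFixedPt_next hf hx
  refine ⟨α.compProj, ?_, fun t ↦ α.compProj_mem_closedBall hf.mul_max_le, fun t ht ↦ ?_⟩
  · have := ODE.FunSpace.compProj_val (α := α) (t := ⟨0, by simp⟩)
    rw [this, ← hα, ODE.FunSpace.next_apply₀]
  · apply ODE.hasDerivWithinAt_picard_Icc (⟨0, by simp⟩ : Icc (0 : ℝ) 1).2 hf.continuousOn_uncurry
      α.continuous_compProj.continuousOn (fun _ _ ↦ α.compProj_mem_closedBall hf.mul_max_le)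
      x₀ ht |>.congr_of_mem _ ht
    intro t' ht'
    nth_rw 1 [← hα]
    rw [ODE.FunSpace.compProj_of_mem ht', ODE.FunSpace.next_apply]

/-- **Frobenius theorem** for a total differential equation `Dc = B ∘ c`: if the derivative of `B`
satisfies the integrability condition, there is a local solution through each point. -/
theorem exists_hasFDerivAt_eq_comp {B : E → F →L[ℝ] E} {S : Set E} (hS : IsOpen S)
    (hB : ContDiffOn ℝ ∞ B S)
    (hsymm : ∀ x ∈ S, ∀ ξ η, fderiv ℝ B x (B x ξ) η = fderiv ℝ B x (B x η) ξ)
    {x₀ : E} (hx₀ : x₀ ∈ S) :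
    ∃ δ > 0, ∃ c : F → E, c 0 = x₀ ∧ (∀ s ∈ ball (0 : F) δ, c s ∈ S) ∧
      (∀ s ∈ ball (0 : F) δ, HasFDerivAt c (B (c s)) s) ∧ ContDiffOn ℝ ∞ c (ball 0 δ) := by
  obtain ⟨a, ha, C, hC, haS, hB0, hB1, hB2⟩ := exists_taylor_bounds hS hB hx₀
  have hlip (s : F) (r : ℝ) (hs : ‖s‖ ≤ r) (hr : 0 ≤ r) :
      LipschitzOnWith (C * r).toNNReal (fun x ↦ B x s) (closedBall x₀ a) := by
    refine (convex_closedBall x₀ a).lipschitzOnWith_of_nnnorm_hasFDerivWithin_le (𝕜 := ℝ)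
      (f' := fun x ↦ (fderiv ℝ B x).flip s) (fun x hx ↦ ?_) fun x hx ↦ ?_
    · have := ((hB.contDiffAt (hS.mem_nhds (haS hx))).differentiableAt (by simp)).hasFDerivAt
      have h2 := (this.clm_apply (hasFDerivAt_const s x)).hasFDerivWithinAt (s := closedBall x₀ a)
      simpa using h2
    · rw [← NNReal.coe_le_coe, coe_nnnorm, Real.coe_toNNReal _ (by positivity)]
      refine ((fderiv ℝ B x).flip.le_opNorm s).trans ?_
      rw [ContinuousLinearMap.opNorm_flip]
      exact mul_le_mul (hB1 x hx) hs (norm_nonneg _) hC.le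
  -- solutions along rays
  have hsol (s : F) (hs : s ∈ ball (0 : F) (a / 2 / C)) : ∃ α : ℝ → E, α 0 = x₀ ∧
      (∀ t, α t ∈ closedBall x₀ (a / 2)) ∧
      ∀ t ∈ Icc (0 : ℝ) 1, HasDerivWithinAt α (B (α t) s) (Icc 0 1) t := by
    have hsub : closedBall x₀ (a / 2) ⊆ closedBall x₀ a :=
      closedBall_subset_closedBall (by linarith)
    -- The speed is at most C‖s‖ < a/2, so the solution stays in the ball of radius a/2. The other
    -- half of `a` is room for the comparison curve `w` below.
    refine exists_solution_Icc_zero_one (by positivity) (fun x hx ↦ ?_)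
      ((hlip s ‖s‖ le_rfl (norm_nonneg _)).mono hsub)
    refine ((B x).le_opNorm s).trans ?_
    rw [mem_ball_zero_iff, lt_div_iff₀ hC] at hs
    nlinarith [hB0 x (hsub hx), norm_nonneg s]
  choose! α hα0 hαmem hα using hsol
  set δ := a / 2 / C with hδ
  have hδ0 : 0 < δ := by positivity
  have key : ∀ s ∈ ball (0 : F) δ, HasFDerivAt (fun s ↦ α s 1) (B (α s 1)) s := by
    intro s hs
    set K : NNReal := (C * δ).toNNReal with hK
    have hK0 : (K : ℝ) ≠ 0 := by
      rw [hK, Real.coe_toNNReal _ (by positivity)]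
      positivity
    set R := (C * C + C * C ^ 2 * δ) with hR
    have hmain : ∀ h : F, ‖h‖ < δ → s + h ∈ ball (0 : F) δ →
        ‖α (s + h) 1 - α s 1 - B (α s 1) h‖ ≤ (R / K * (Real.exp K - 1)) * ‖h‖ ^ 2 := by
      intro h hh hsh
      -- First-order guess for the solution along the ray of `s + h`: if Dc = B ∘ c, the variation
      -- of c(ts) when `s` moves by `h` is t B(c(ts))h.
      set w : ℝ → E := fun t ↦ α s t + t • B (α s t) h with hw
      have hsub : closedBall x₀ (a / 2) ⊆ closedBall x₀ a :=
        closedBall_subset_closedBall (by linarith)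
      have hBh : ∀ t, ‖B (α s t) h‖ ≤ C * ‖h‖ := fun t ↦
        ((B (α s t)).le_opNorm h).trans
          (mul_le_mul_of_nonneg_right (hB0 _ (hsub (hαmem s hs t))) (norm_nonneg _))
      have hwmem : ∀ t ∈ Icc (0 : ℝ) 1, w t ∈ closedBall x₀ a := by
        intro t ht
        have h1 := hαmem s hs t
        rw [mem_closedBall_iff_norm] at h1 ⊢
        have h2 : ‖t • B (α s t) h‖ ≤ a / 2 := by
          rw [norm_smul, Real.norm_of_nonneg ht.1]
          calc t * ‖B (α s t) h‖ ≤ 1 * (C * ‖h‖) :=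
                mul_le_mul ht.2 (hBh t) (norm_nonneg _) zero_le_one
            _ ≤ C * δ := by rw [one_mul]; gcongr
            _ = a / 2 := by rw [hδ]; field_simp
        calc ‖w t - x₀‖ = ‖(α s t - x₀) + t • B (α s t) h‖ := by rw [hw, sub_add_eq_add_sub]
          _ ≤ a / 2 + a / 2 := (norm_add_le _ _).trans (add_le_add h1 h2)
          _ = a := by ring
      set w' : ℝ → E := fun t ↦ B (α s t) s +
        (t • fderiv ℝ B (α s t) (B (α s t) s) h + B (α s t) h) with hw'
      have hwd : ∀ t ∈ Icc (0 : ℝ) 1, HasDerivWithinAt w (w' t) (Icc 0 1) t := by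
        intro t ht
        have hu := hα s hs t ht
        have hBd := ((hB.contDiffAt (hS.mem_nhds (haS (hsub (hαmem s hs t))))).differentiableAt
          (by simp)).hasFDerivAt.comp_hasDerivWithinAt t hu
        have h3 := hBd.clm_apply (hasDerivWithinAt_const t (Icc 0 1) h)
        have h4 := hu.add ((hasDerivWithinAt_id t (Icc 0 1)).smul h3)
        refine h4.congr_deriv ?_
        simp [hw']
      have hbound : ∀ t ∈ Icc (0 : ℝ) 1,
          dist (w' t) (B (w t) (s + h)) ≤ R * ‖h‖ ^ 2 := by
        intro t ht
        have hrem := hB2 _ (hsub (hαmem s hs t)) _ (hwmem t ht)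
        have hwu : w t - α s t = t • B (α s t) h := by simp [hw]
        have hwu' : ‖w t - α s t‖ ≤ C * ‖h‖ := by
          rw [hwu, norm_smul, Real.norm_of_nonneg ht.1]
          exact (mul_le_of_le_one_left (norm_nonneg _) ht.2).trans (hBh t)
        set Rm := B (w t) - B (α s t) - fderiv ℝ B (α s t) (w t - α s t) with hRm
        have heq : w' t - B (w t) (s + h) =
            -(t • fderiv ℝ B (α s t) (B (α s t) h) h) - Rm (s + h) := by
          have h5 : B (w t) = B (α s t) + fderiv ℝ B (α s t) (w t - α s t) + Rm := by
            rw [hRm]; abel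
          rw [h5, hwu, hw']
          simp only [map_add, map_smul, add_apply, smul_apply]
          -- Integrability enters here: it cancels the terms of first order in `h`, so `w` fails to
          -- solve the equation only by O(‖h‖²).
          rw [hsymm _ (haS (hsub (hαmem s hs t))) h s]
          abel
        rw [dist_eq_norm, heq]
        have e1 : ‖t • fderiv ℝ B (α s t) (B (α s t) h) h‖ ≤ C * C * ‖h‖ ^ 2 := by
          rw [norm_smul, Real.norm_of_nonneg ht.1]
          refine (mul_le_of_le_one_left (norm_nonneg _) ht.2).trans ?_
          refine ((fderiv ℝ B (α s t)).le_opNorm₂ _ _).trans ?_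
          calc _ ≤ C * (C * ‖h‖) * ‖h‖ := by
                gcongr
                · exact hB1 _ (hsub (hαmem s hs t))
                · exact hBh t
            _ = _ := by ring
        have e2 : ‖Rm (s + h)‖ ≤ C * C ^ 2 * δ * ‖h‖ ^ 2 := by
          refine (Rm.le_opNorm _).trans ?_
          calc _ ≤ (C * (C * ‖h‖) ^ 2) * δ := by
                gcongr
                · exact hrem.trans (by gcongr)
                · exact (mem_ball_zero_iff.1 hsh).le
            _ = _ := by ring
        calc _ ≤ ‖-(t • fderiv ℝ B (α s t) (B (α s t) h) h)‖ + ‖Rm (s + h)‖ := norm_sub_le _ _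
          _ ≤ C * C * ‖h‖ ^ 2 + C * C ^ 2 * δ * ‖h‖ ^ 2 := by
              rw [norm_neg]; exact add_le_add e1 e2
          _ = R * ‖h‖ ^ 2 := by rw [hR]; ring
      have hIci : ∀ {f : ℝ → E} {f' : E} {t : ℝ}, t ∈ Ico (0 : ℝ) 1 →
          HasDerivWithinAt f f' (Icc 0 1) t → HasDerivWithinAt f f' (Ici t) t :=
        fun ht hf ↦ hf.mono_of_mem_nhdsWithin (Icc_mem_nhdsGE_of_mem ht)
      -- Grönwall compares the exact solution with `w`. Both start at `x₀`, so at time 1 they differ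
      -- by O(‖h‖²), which says that the endpoint map has derivative `B (α s 1)` at `s`.
      have hgron := dist_le_of_approx_trajectories_ODE_of_mem (a := 0) (b := 1)
        (v := fun _ x ↦ B x (s + h)) (s := fun _ ↦ closedBall x₀ a) (K := K)
        (f := α (s + h)) (g := w) (f' := fun t ↦ B (α (s + h) t) (s + h)) (g' := w')
        (εf := 0) (εg := R * ‖h‖ ^ 2) (δ := 0)
        (fun t _ ↦ hlip (s + h) δ (mem_ball_zero_iff.1 hsh).le hδ0.le)
        (fun t ht ↦ (hα _ hsh t ht).continuousWithinAt)
        (fun t ht ↦ hIci ht (hα _ hsh t (Ico_subset_Icc_self ht)))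
        (fun t _ ↦ by rw [dist_self])
        (fun t _ ↦ hsub (hαmem _ hsh t))
        (fun t ht ↦ (hwd t ht).continuousWithinAt)
        (fun t ht ↦ hIci ht (hwd t (Ico_subset_Icc_self ht)))
        (fun t ht ↦ hbound t (Ico_subset_Icc_self ht))
        (fun t ht ↦ hwmem t (Ico_subset_Icc_self ht))
        (by simp [hw, hα0 s hs, hα0 _ hsh]) 1 (by simp)
      rw [gronwallBound_of_K_ne_0 hK0, dist_eq_norm] at hgron
      calc _ = ‖α (s + h) 1 - w 1‖ := by congr 1; simp [hw, sub_sub]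
        _ ≤ _ := hgron
        _ = _ := by simp; ring
    rw [hasFDerivAt_iff_isLittleO_nhds_zero]
    refine Asymptotics.IsBigO.trans_isLittleO
      (g := fun h : F ↦ ‖h‖ ^ 2) (Asymptotics.IsBigO.of_bound (R / K * (Real.exp K - 1)) ?_)
      (Asymptotics.isLittleO_norm_pow_id one_lt_two)
    have hev : ∀ᶠ h in 𝓝 (0 : F), s + h ∈ ball (0 : F) δ := by
      have : Filter.Tendsto (fun h : F ↦ s + h) (𝓝 0) (𝓝 s) := by
        simpa using (continuous_const_add s).tendsto (0 : F)
      exact this.eventually_mem (isOpen_ball.mem_nhds hs)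
    filter_upwards [hev, ball_mem_nhds (0 : F) hδ0] with h h1 h2
    rw [Real.norm_of_nonneg (by positivity)]
    exact hmain h (mem_ball_zero_iff.1 h2) h1
  have hcS : ∀ s ∈ ball (0 : F) δ, α s 1 ∈ S := fun s hs ↦
    haS (closedBall_subset_closedBall (by linarith) (hαmem s hs 1))
  refine ⟨δ, hδ0, fun s ↦ α s 1, ?_, hcS, key,
    contDiffOn_of_hasFDerivAt_comp hB isOpen_ball hcS key⟩
  have h0 : (0 : F) ∈ ball (0 : F) δ := mem_ball_self hδ0
  -- For s = 0 the equation along the ray reads α' = 0.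
  have hconst := constant_of_has_deriv_right_zero (f := α 0) (a := 0) (b := 1)
    (fun t ht ↦ (hα 0 h0 t ht).continuousWithinAt)
    (fun t ht ↦ by
      have := (hα 0 h0 t (Ico_subset_Icc_self ht)).mono_of_mem_nhdsWithin
        (Icc_mem_nhdsGE_of_mem ht)
      simpa using this)
  exact (hconst 1 (by simp)).trans (hα0 0 h0)

end Frobenius

/-! ### The Jacobiator in a vector space: Jacobi sum, Lie bracket, exterior derivative. -/

section Calculus

open Set

variable {E : Type*} [NormedAddCommGroup E] [NormedSpace ℝ E]
  {F : Type*} [NormedAddCommGroup F] [NormedSpace ℝ F]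
  {G : Type*} [NormedAddCommGroup G] [NormedSpace ℝ G]

/-- The Jacobiator of the bivector field whose associated homomorphism from covectors to vectors
is `Q`, evaluated on three constant covectors. -/
def jacobiator (Q : E → (E →L[ℝ] ℝ) →L[ℝ] E) (z : E) (a b c : E →L[ℝ] ℝ) : ℝ :=
  c (fderiv ℝ Q z (Q z a) b) + a (fderiv ℝ Q z (Q z b) c) + b (fderiv ℝ Q z (Q z c) a)

/-- The skewness identity holds on a neighborhood, so it can be differentiated. -/
theorem fderiv_skew {Q : E → (E →L[ℝ] ℝ) →L[ℝ] E} {z : E}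
    (hQ : ∀ᶠ y in 𝓝 z, ∀ a b : E →L[ℝ] ℝ, b (Q y a) = -a (Q y b)) (hd : DifferentiableAt ℝ Q z)
    (ζ : E) (a b : E →L[ℝ] ℝ) : b (fderiv ℝ Q z ζ a) = -a (fderiv ℝ Q z ζ b) := by
  have h1 (a b : E →L[ℝ] ℝ) : HasFDerivAt (fun y ↦ b (Q y a)) (b ∘L (fderiv ℝ Q z).flip a) z := by
    refine b.hasFDerivAt.comp z ?_
    simpa using hd.hasFDerivAt.clm_apply (hasFDerivAt_const a z)
  have h2 := (h1 a b).congr_of_eventuallyEq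
    (f₁ := fun y ↦ -a (Q y b)) (hQ.mono fun y hy ↦ (hy a b).symm)
  have h3 := congrArg (fun L : E →L[ℝ] ℝ ↦ L ζ) (h2.unique (h1 b a).neg)
  simpa using h3

/-- The Jacobi sum of three functions is the Jacobiator of their differentials. -/
theorem cyclic_bracket_eq_jacobiator {Q : E → (E →L[ℝ] ℝ) →L[ℝ] E} {z : E}
    (hQ : ∀ a b : E →L[ℝ] ℝ, b (Q z a) = -a (Q z b)) (hd : DifferentiableAt ℝ Q z)
    {f₁ f₂ f₃ : E → ℝ} (h₁ : ContDiffAt ℝ 2 f₁ z) (h₂ : ContDiffAt ℝ 2 f₂ z)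
    (h₃ : ContDiffAt ℝ 2 f₃ z) :
    fderiv ℝ (fun y ↦ fderiv ℝ f₃ y (Q y (fderiv ℝ f₂ y))) z (Q z (fderiv ℝ f₁ z)) +
      fderiv ℝ (fun y ↦ fderiv ℝ f₁ y (Q y (fderiv ℝ f₃ y))) z (Q z (fderiv ℝ f₂ z)) +
      fderiv ℝ (fun y ↦ fderiv ℝ f₂ y (Q y (fderiv ℝ f₁ y))) z (Q z (fderiv ℝ f₃ z)) =
    jacobiator Q z (fderiv ℝ f₁ z) (fderiv ℝ f₂ z) (fderiv ℝ f₃ z) := by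
  have hdd {f : E → ℝ} (hf : ContDiffAt ℝ 2 f z) :
      HasFDerivAt (fderiv ℝ f) (fderiv ℝ (fderiv ℝ f) z) z :=
    ((hf.fderiv_right (m := 1) (by norm_num)).differentiableAt (by simp)).hasFDerivAt
  have hsy {f : E → ℝ} (hf : ContDiffAt ℝ 2 f z) (v w : E) :
      fderiv ℝ (fderiv ℝ f) z v w = fderiv ℝ (fderiv ℝ f) z w v :=
    hf.isSymmSndFDerivAt (by simp) v w
  have key {f g : E → ℝ} (hf : ContDiffAt ℝ 2 f z) (hg : ContDiffAt ℝ 2 g z) (v : E) :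
      fderiv ℝ (fun y ↦ fderiv ℝ f y (Q y (fderiv ℝ g y))) z v =
        fderiv ℝ f z (fderiv ℝ Q z v (fderiv ℝ g z)) +
        fderiv ℝ f z (Q z (fderiv ℝ (fderiv ℝ g) z v)) +
        fderiv ℝ (fderiv ℝ f) z v (Q z (fderiv ℝ g z)) := by
    rw [((hdd hf).clm_apply (hd.hasFDerivAt.clm_apply (hdd hg))).fderiv]
    simp
    ring
  -- Skewness of `Q` turns each term with a Hessian inside `Q` into minus a value of that Hessian on
  -- two Hamiltonian vectors. By symmetry this cancels the explicit term with the same Hessian.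
  rw [key h₃ h₂, key h₁ h₃, key h₂ h₁, jacobiator,
    hQ (fderiv ℝ (fderiv ℝ f₂) z _), hQ (fderiv ℝ (fderiv ℝ f₁) z _),
    hQ (fderiv ℝ (fderiv ℝ f₃) z _), hsy h₁ (Q z (fderiv ℝ f₃ z)),
    hsy h₂ (Q z (fderiv ℝ f₁ z)), hsy h₃ (Q z (fderiv ℝ f₂ z))]
  ring

theorem fderiv_apply_field {Q : E → G →L[ℝ] E} {z : E} (hd : DifferentiableAt ℝ Q z)
    {α : E → G} (hα : DifferentiableAt ℝ α z) (v : E) :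
    fderiv ℝ (fun y ↦ Q y (α y)) z v = fderiv ℝ Q z v (α z) + Q z (fderiv ℝ α z v) := by
  rw [(hd.hasFDerivAt.clm_apply hα.hasFDerivAt).fderiv]
  simp [add_comm]

/-- The product rule separates the bracket with frozen coefficients from a remainder that visibly
lies in the image of `Q z`; only the first part can obstruct involutivity. -/
theorem lieBracket_apply_field {Q : E → G →L[ℝ] E} {z : E} (hd : DifferentiableAt ℝ Q z)
    {α β : E → G} (hα : DifferentiableAt ℝ α z) (hβ : DifferentiableAt ℝ β z) :
    VectorField.lieBracket ℝ (fun y ↦ Q y (α y)) (fun y ↦ Q y (β y)) z =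
      (fderiv ℝ Q z (Q z (α z)) (β z) - fderiv ℝ Q z (Q z (β z)) (α z)) +
        Q z (fderiv ℝ β z (Q z (α z)) - fderiv ℝ α z (Q z (β z))) := by
  rw [VectorField.lieBracket_eq]
  simp only
  rw [fderiv_apply_field hd hα, fderiv_apply_field hd hβ, map_sub]
  abel

/-- If the Jacobiator vanishes, the bracket of two fields `Q a`, `Q b` with constant `a`, `b` is
the image of the differential of the bracket of `a` and `b`. -/
theorem fderiv_sub_fderiv_of_jacobiator_eq_zero {Q : E → (E →L[ℝ] ℝ) →L[ℝ] E} {z : E}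
    (hQ : ∀ᶠ y in 𝓝 z, ∀ a b : E →L[ℝ] ℝ, b (Q y a) = -a (Q y b)) (hd : DifferentiableAt ℝ Q z)
    (hJ : ∀ a b c, jacobiator Q z a b c = 0) (a b : E →L[ℝ] ℝ) :
    fderiv ℝ Q z (Q z a) b - fderiv ℝ Q z (Q z b) a = Q z (b ∘L (fderiv ℝ Q z).flip a) := by
  rw [SeparatingDual.eq_iff_forall_dual_eq (R := ℝ)]
  intro w
  have h1 := hJ a b w
  rw [jacobiator, fderiv_skew hQ hd _ w a] at h1
  rw [hQ.self_of_nhds _ w, map_sub]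
  simp only [ContinuousLinearMap.comp_apply, ContinuousLinearMap.flip_apply]
  linarith

/-- Cartan's formula for a two-form that corresponds, along `c`, to the bivector field `Q`: its
exterior derivative on the fields corresponding to constant covectors is the Jacobiator. -/
theorem extDeriv_eq_jacobiator {Q : E → (E →L[ℝ] ℝ) →L[ℝ] E} {c : F → E} {u₀ : F}
    (hQ : ∀ᶠ y in 𝓝 (c u₀), ∀ a b : E →L[ℝ] ℝ, b (Q y a) = -a (Q y b))
    (hd : DifferentiableAt ℝ Q (c u₀)) (hc : ContDiffAt ℝ 2 c u₀)
    {σ : F → F [⋀^Fin 2]→L[ℝ] ℝ} (hσ : DifferentiableAt ℝ σ u₀)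
    {X : (E →L[ℝ] ℝ) → F → F} (hX : ∀ a, DifferentiableAt ℝ (X a) u₀)
    (hcX : ∀ a, ∀ᶠ u in 𝓝 u₀, fderiv ℝ c u (X a u) = Q (c u) a)
    (hσX : ∀ a, ∀ᶠ u in 𝓝 u₀, ∀ η, σ u ![X a u, η] = a (fderiv ℝ c u η))
    (a b w : E →L[ℝ] ℝ) :
    extDeriv σ u₀ ![X a u₀, X b u₀, X w u₀] = jacobiator Q (c u₀) a b w := by
  have hc1 : HasFDerivAt c (fderiv ℝ c u₀) u₀ := (hc.differentiableAt (by simp)).hasFDerivAt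
  have hc2 : HasFDerivAt (fderiv ℝ c) (fderiv ℝ (fderiv ℝ c) u₀) u₀ :=
    ((hc.fderiv_right (m := 1) (by norm_num)).differentiableAt (by simp)).hasFDerivAt
  have hsy (v w : F) : fderiv ℝ (fderiv ℝ c) u₀ v w = fderiv ℝ (fderiv ℝ c) u₀ w v :=
    hc.isSymmSndFDerivAt (by simp) v w
  have hQc : HasFDerivAt (fun u ↦ Q (c u)) (fderiv ℝ Q (c u₀) ∘L fderiv ℝ c u₀) u₀ :=
    hd.hasFDerivAt.comp u₀ hc1
  -- Obtained by differentiating the relation Dc(X_b) = Q(c)b; it eliminates the derivatives of the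
  -- fields from the formulas below.
  have hXd (b : E →L[ℝ] ℝ) (ζ : F) : fderiv ℝ c u₀ (fderiv ℝ (X b) u₀ ζ) =
      fderiv ℝ Q (c u₀) (fderiv ℝ c u₀ ζ) b - fderiv ℝ (fderiv ℝ c) u₀ ζ (X b u₀) := by
    have h1 := hc2.clm_apply (hX b).hasFDerivAt
    have h2 := (hQc.clm_apply (hasFDerivAt_const b u₀)).congr_of_eventuallyEq (hcX b)
    have h3 := congrArg (fun L : F →L[ℝ] E ↦ L ζ) (h1.unique h2)
    simp at h3
    rw [← h3]
    abel
  have hswap (u : F) (ξ η : F) : σ u ![ξ, η] = -σ u ![η, ξ] := by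
    have := (σ u).map_swap ![η, ξ] (i := 0) (j := 1) (by simp)
    refine Eq.trans (congrArg (σ u) ?_) this
    ext i
    fin_cases i <;> simp
  -- Obtained by differentiating σ(X_a, X_b) = a(Q(c)b) and moving the terms with derivatives of the
  -- fields to the right, where the defining property of σ evaluates them.
  have hσd (a b : E →L[ℝ] ℝ) (ζ : F) :
      fderiv ℝ σ u₀ ζ ![X a u₀, X b u₀] = b (fderiv ℝ Q (c u₀) (fderiv ℝ c u₀ ζ) a) +
        a (fderiv ℝ (fderiv ℝ c) u₀ ζ (X b u₀)) - b (fderiv ℝ (fderiv ℝ c) u₀ ζ (X a u₀)) := by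
    have h1 := hσ.hasFDerivAt.continuousAlternatingMap_apply (g := ![X a, X b])
      (g' := ![fderiv ℝ (X a) u₀, fderiv ℝ (X b) u₀])
      (fun i ↦ by fin_cases i <;> [exact (hX a).hasFDerivAt; exact (hX b).hasFDerivAt])
    have h2 : HasFDerivAt (fun u ↦ a (Q (c u) b)) (a ∘L (fderiv ℝ Q (c u₀) ∘L fderiv ℝ c u₀).flip b)
        u₀ := by
      refine a.hasFDerivAt.comp u₀ ?_
      simpa using hQc.clm_apply (hasFDerivAt_const b u₀)
    have h3 : (fun u ↦ σ u fun i ↦ (![X a, X b] : Fin 2 → F → F) i u) =ᶠ[𝓝 u₀]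
        fun u ↦ a (Q (c u) b) := by
      filter_upwards [hcX b, hσX a] with u h4 h5
      rw [← h4, ← h5]
      congr 1
      ext i
      fin_cases i <;> simp
    have h4 := congrArg (fun L : F →L[ℝ] ℝ ↦ L ζ) (h1.unique (h2.congr_of_eventuallyEq h3))
    have e1 : (fun i ↦ (![X a, X b] : Fin 2 → F → F) i u₀) = ![X a u₀, X b u₀] := by
      ext i
      fin_cases i <;> simp
    rw [e1] at h4
    have e2 : Function.update ![X a u₀, X b u₀] 0 (fderiv ℝ (X a) u₀ ζ) =
        ![fderiv ℝ (X a) u₀ ζ, X b u₀] := by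
      ext i
      fin_cases i <;> simp
    have e3 : Function.update ![X a u₀, X b u₀] 1 (fderiv ℝ (X b) u₀ ζ) =
        ![X a u₀, fderiv ℝ (X b) u₀ ζ] := by
      ext i
      fin_cases i <;> simp
    simp [Fin.sum_univ_two, e2, e3] at h4
    rw [(hσX a).self_of_nhds, hswap, (hσX b).self_of_nhds, hXd, hXd, map_sub, map_sub] at h4
    linarith
  have hform (v : Fin 3 → F) : extDeriv σ u₀ v = fderiv ℝ σ u₀ (v 0) ![v 1, v 2] -
      fderiv ℝ σ u₀ (v 1) ![v 0, v 2] + fderiv ℝ σ u₀ (v 2) ![v 0, v 1] := by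
    rw [extDeriv_apply hσ]
    have e (i : Fin 3) (x : F) : fderiv ℝ (fun x ↦ σ x (i.removeNth v)) u₀ x =
        fderiv ℝ σ u₀ x (i.removeNth v) := by
      rw [fderiv_continuousAlternatingMap_apply_const_apply hσ]
    simp only [e]
    have r0 : (0 : Fin 3).removeNth v = ![v 1, v 2] := by
      ext i
      fin_cases i <;> rfl
    have r1 : (1 : Fin 3).removeNth v = ![v 0, v 2] := by
      ext i
      fin_cases i <;> rfl
    have r2 : (2 : Fin 3).removeNth v = ![v 0, v 1] := by
      ext i
      fin_cases i <;> rfl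
    refine (Fin.sum_univ_three _).trans ?_
    rw [r0, r1, r2]
    simp
    ring
  rw [hform]
  simp only [Matrix.cons_val]
  -- The six terms with second derivatives of `c` cancel in pairs by symmetry; those with DQ form
  -- the Jacobiator.
  rw [hσd, hσd, hσd, (hcX a).self_of_nhds, (hcX b).self_of_nhds, (hcX w).self_of_nhds,
    hsy (X a u₀) (X b u₀), hsy (X a u₀) (X w u₀), hsy (X b u₀) (X w u₀), jacobiator,
    fderiv_skew hQ hd (Q (c u₀) b) a w]
  ring

end Calculus

/-! ### Smooth frames, leaf forms in coordinates, and the Frobenius theorem for constant rank. -/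

section LocalInverse

open Set Module

variable {E : Type*} [NormedAddCommGroup E] [NormedSpace ℝ E]
  {F : Type*} [NormedAddCommGroup F] [NormedSpace ℝ F]
  {G : Type*} [NormedAddCommGroup G] [NormedSpace ℝ G]
  {X : Type*} [NormedAddCommGroup X] [NormedSpace ℝ X]

theorem exists_clm_leftInverse [FiniteDimensional ℝ E] {D : F →L[ℝ] E}
    (hD : Function.Injective D) :
    ∃ p : E →L[ℝ] F, p ∘L D = .id ℝ F := by
  obtain ⟨g, hg⟩ := LinearMap.exists_leftInverse_of_injective D.toLinearMap
    (LinearMap.ker_eq_bot.2 hD)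
  refine ⟨g.toContinuousLinearMap, ?_⟩
  ext x
  exact LinearMap.congr_fun hg x

theorem exists_clm_lift [FiniteDimensional ℝ F] {D : F →L[ℝ] E} {Q : G →L[ℝ] E}
    (h : ∀ ξ, ∃ a, Q a = D ξ) :
    ∃ e : F →L[ℝ] G, Q ∘L e = D := by
  have h' : D.toLinearMap.range ≤ Q.toLinearMap.range := by
    rintro _ ⟨ξ, rfl⟩
    exact h ξ
  obtain ⟨g, hg⟩ := Module.projective_lifting_property Q.toLinearMap.rangeRestrict
    (D.toLinearMap.codRestrict Q.toLinearMap.range fun ξ ↦ h' ⟨ξ, rfl⟩)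
    Q.toLinearMap.surjective_rangeRestrict
  refine ⟨g.toContinuousLinearMap, ?_⟩
  ext ξ
  exact congrArg Subtype.val (LinearMap.congr_fun hg ξ)

theorem eventually_isInvertible [FiniteDimensional ℝ F] {Y : Type*} [TopologicalSpace Y]
    {N : Y → F →L[ℝ] F} {x₀ : Y}
    (hN : ContinuousAt N x₀) (h : N x₀ = .id ℝ F) : ∀ᶠ x in 𝓝 x₀, (N x).IsInvertible := by
  have h1 := (ContinuousLinearEquiv.refl ℝ F).nhds
  have h2 : ((ContinuousLinearEquiv.refl ℝ F : F ≃L[ℝ] F) : F →L[ℝ] F) = N x₀ := h.symm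
  rw [h2] at h1
  exact hN h1

theorem contDiffAt_inverse_of_isInvertible [FiniteDimensional ℝ F] {N : X → F →L[ℝ] F}
    {x₀ : X} {n : WithTop ℕ∞}
    (hN : ContDiffAt ℝ n N x₀) (h : (N x₀).IsInvertible) :
    ContDiffAt ℝ n (fun x ↦ (N x).inverse) x₀ := by
  obtain ⟨e, he⟩ := h
  have := contDiffAt_map_inverse (𝕜 := ℝ) (n := n) e
  rw [he] at this
  exact this.comp x₀ hN

/-- A smooth family of linear maps that is injective at a point has a smooth family of left
inverses near that point. -/
theorem exists_smooth_leftInverse [FiniteDimensional ℝ E] [FiniteDimensional ℝ F]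
    {A : X → F →L[ℝ] E} {u₀ : X} (hA : ContDiffAt ℝ ∞ A u₀) (hinj : Function.Injective (A u₀)) :
    ∃ l : X → E →L[ℝ] F, ContDiffAt ℝ ∞ l u₀ ∧ ∀ᶠ u in 𝓝 u₀, l u ∘L A u = .id ℝ F := by
  obtain ⟨p, hp⟩ := exists_clm_leftInverse hinj
  have hN : ContDiffAt ℝ ∞ (fun u ↦ p ∘L A u) u₀ := contDiffAt_const.clm_comp hA
  have hinv := eventually_isInvertible hN.continuousAt hp
  refine ⟨fun u ↦ (p ∘L A u).inverse ∘L p,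
    (contDiffAt_inverse_of_isInvertible hN hinv.self_of_nhds).clm_comp contDiffAt_const, ?_⟩
  filter_upwards [hinv] with u hu
  exact hu.inverse_comp_self

/-- A two-form `σ` corresponds along `c` to the homomorphism `Q` from covectors to vectors if
`σ(ξ, η) = a (Dc η)` whenever `Dc ξ = Q a`. -/
def IsLeafForm (Q : E → (E →L[ℝ] ℝ) →L[ℝ] E) (c : F → E) (σ : F → F [⋀^Fin 2]→L[ℝ] ℝ)
    (u : F) : Prop :=
  ∀ a ξ η, fderiv ℝ c u ξ = Q (c u) a → σ u ![ξ, η] = a (fderiv ℝ c u η)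

/-- Left inverses of Dc extend the given vectors to smooth fields related by `c` to the fields Qa,
Qb, Qw, so the Cartan formula applies. -/
theorem IsLeafForm.extDeriv_eq [FiniteDimensional ℝ E] [FiniteDimensional ℝ F]
    {Q : E → (E →L[ℝ] ℝ) →L[ℝ] E} {c : F → E} {u₀ : F}
    (hQ : ∀ᶠ y in 𝓝 (c u₀), ∀ a b : E →L[ℝ] ℝ, b (Q y a) = -a (Q y b))
    (hd : ContDiffAt ℝ ∞ Q (c u₀)) (hc : ContDiffAt ℝ ∞ c u₀)
    (hinj : Function.Injective (fderiv ℝ c u₀))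
    (hrange : ∀ᶠ u in 𝓝 u₀, ∀ a, ∃ ξ, fderiv ℝ c u ξ = Q (c u) a)
    {σ : F → F [⋀^Fin 2]→L[ℝ] ℝ} (hσ : DifferentiableAt ℝ σ u₀)
    (hform : ∀ᶠ u in 𝓝 u₀, IsLeafForm Q c σ u)
    {a b w : E →L[ℝ] ℝ} {ξ η ζ : F} (hξ : fderiv ℝ c u₀ ξ = Q (c u₀) a)
    (hη : fderiv ℝ c u₀ η = Q (c u₀) b) (hζ : fderiv ℝ c u₀ ζ = Q (c u₀) w) :
    extDeriv σ u₀ ![ξ, η, ζ] = jacobiator Q (c u₀) a b w := by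
  obtain ⟨l, hl, hleft⟩ := exists_smooth_leftInverse
    (hc.fderiv_right (m := ∞) (by simp)) hinj
  have hcX (a : E →L[ℝ] ℝ) : ∀ᶠ u in 𝓝 u₀, fderiv ℝ c u (l u (Q (c u) a)) = Q (c u) a := by
    filter_upwards [hrange, hleft] with u h1 h2
    obtain ⟨ξ, hξ⟩ := h1 a
    rw [← hξ]
    exact congrArg (fderiv ℝ c u) (DFunLike.congr_fun h2 ξ)
  have hval {a : E →L[ℝ] ℝ} {ξ : F} (h : fderiv ℝ c u₀ ξ = Q (c u₀) a) :
      l u₀ (Q (c u₀) a) = ξ := hinj ((hcX a).self_of_nhds.trans h.symm)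
  have := extDeriv_eq_jacobiator hQ (hd.differentiableAt (by simp))
    (by exact_mod_cast contDiffAt_infty.1 hc 2) hσ (X := fun a u ↦ l u (Q (c u) a))
    (fun a ↦ (hl.clm_apply ((hd.comp u₀ hc).clm_apply contDiffAt_const)).differentiableAt
      (by simp)) hcX
    (fun a ↦ by
      filter_upwards [hform, hcX a] with u h1 h2 η
      exact h1 a _ η h2) a b w
  simpa only [hval hξ, hval hη, hval hζ] using this

/-- The alternating form that agrees with a bilinear form when the latter is alternating. -/
def alternatize (F : Type*) [NormedAddCommGroup F] [NormedSpace ℝ F] :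
    (F →L[ℝ] F →L[ℝ] ℝ) →L[ℝ] F [⋀^Fin 2]→L[ℝ] ℝ :=
  (2⁻¹ : ℝ) • (ContinuousAlternatingMap.alternatizeUncurryFinCLM ℝ F ℝ (n := 1) ∘L
    ContinuousLinearMap.compL ℝ F (F →L[ℝ] ℝ) (F [⋀^Fin 1]→L[ℝ] ℝ)
      (ContinuousAlternatingMap.ofSubsingletonLIE (𝕜 := ℝ) (E := F) (F := ℝ)
        (0 : Fin 1)).toContinuousLinearEquiv.toContinuousLinearMap)

theorem alternatize_apply (β : F →L[ℝ] F →L[ℝ] ℝ) (ξ η : F) :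
    alternatize F β ![ξ, η] = 2⁻¹ * (β ξ η - β η ξ) := by
  simp [alternatize, ContinuousAlternatingMap.alternatizeUncurryFin_apply, Fin.sum_univ_two,
    sub_eq_add_neg, Fin.removeNth]

theorem alternatize_apply_of_skew {β : F →L[ℝ] F →L[ℝ] ℝ} (h : ∀ ξ η, β ξ η = -β η ξ) (ξ η : F) :
    alternatize F β ![ξ, η] = β ξ η := by
  rw [alternatize_apply, h η ξ]
  ring

theorem alternating_swap (τ : F [⋀^Fin 2]→L[ℝ] ℝ) (ξ η : F) : τ ![ξ, η] = -τ ![η, ξ] := by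
  have := τ.map_swap ![η, ξ] (i := 0) (j := 1) (by simp)
  refine Eq.trans (congrArg τ ?_) this
  ext i
  fin_cases i <;> simp

/-- A fixed frame of covectors at `u₀` still works nearby, and inverting a matrix gives a smooth θ
with Dc = Q(c) ∘ θ. The defining property then forces σ(ξ, η) = θ(ξ)(Dc η), which is smooth. -/
theorem IsLeafForm.contDiffAt [FiniteDimensional ℝ E] [FiniteDimensional ℝ F]
    {Q : E → (E →L[ℝ] ℝ) →L[ℝ] E} {c : F → E} {u₀ : F}
    (hd : ContDiffAt ℝ ∞ Q (c u₀)) (hc : ContDiffAt ℝ ∞ c u₀)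
    (hinj : Function.Injective (fderiv ℝ c u₀))
    (hrange : ∀ᶠ u in 𝓝 u₀, ∀ a, ∃ ξ, fderiv ℝ c u ξ = Q (c u) a)
    (hrange' : ∀ ξ, ∃ a, Q (c u₀) a = fderiv ℝ c u₀ ξ)
    {σ : F → F [⋀^Fin 2]→L[ℝ] ℝ} (hform : ∀ᶠ u in 𝓝 u₀, IsLeafForm Q c σ u) :
    ContDiffAt ℝ ∞ σ u₀ := by
  obtain ⟨p, hp⟩ := exists_clm_leftInverse hinj
  obtain ⟨e, he⟩ := exists_clm_lift hrange'
  have hc' : ContDiffAt ℝ ∞ (fderiv ℝ c) u₀ := hc.fderiv_right (m := ∞) (by simp)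
  have hN : ContDiffAt ℝ ∞ (fun u ↦ p ∘L Q (c u) ∘L e) u₀ :=
    contDiffAt_const.clm_comp ((hd.comp u₀ hc).clm_comp contDiffAt_const)
  have hN0 : p ∘L Q (c u₀) ∘L e = .id ℝ F := by rw [he, hp]
  have hNinv := eventually_isInvertible hN.continuousAt hN0
  have hDinv := eventually_isInvertible (N := fun u ↦ p ∘L fderiv ℝ c u)
    (contDiffAt_const.clm_comp hc').continuousAt hp
  set θ : F → F →L[ℝ] E →L[ℝ] ℝ :=
    fun u ↦ e ∘L (p ∘L Q (c u) ∘L e).inverse ∘L p ∘L fderiv ℝ c u with hθ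
  have hθc : ContDiffAt ℝ ∞ θ u₀ := contDiffAt_const.clm_comp
    ((contDiffAt_inverse_of_isInvertible hN hNinv.self_of_nhds).clm_comp
      (contDiffAt_const.clm_comp hc'))
  have hβ : ContDiffAt ℝ ∞
      (fun u ↦ alternatize F (((ContinuousLinearMap.compL ℝ F E ℝ).flip (fderiv ℝ c u)) ∘L θ u))
      u₀ :=
    (alternatize F).contDiff.contDiffAt.comp u₀
      ((((ContinuousLinearMap.compL ℝ F E ℝ).flip.contDiff.contDiffAt).comp u₀ hc').clm_comp hθc)
  refine hβ.congr_of_eventuallyEq ?_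
  filter_upwards [hform, hNinv, hDinv, hrange] with u h1 h2 h3 h4
  -- Both sides lie in the range of Dc, on which `p` is injective near `u₀`, so equality after `p`
  -- suffices.
  have hlift (ξ : F) : fderiv ℝ c u ξ = Q (c u) (θ u ξ) := by
    obtain ⟨ζ, hζ⟩ := h4 (θ u ξ)
    have h5 : p (fderiv ℝ c u ζ) = p (fderiv ℝ c u ξ) := by
      rw [hζ]
      exact h2.self_apply_inverse (p (fderiv ℝ c u ξ))
    rw [← hζ, h3.injective h5]
  have hval (ξ η : F) : σ u ![ξ, η] = θ u ξ (fderiv ℝ c u η) := h1 _ ξ η (hlift ξ)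
  ext v
  have hv : v = ![v 0, v 1] := by
    ext i
    fin_cases i <;> rfl
  rw [hv, alternatize_apply_of_skew, hval]
  · rfl
  · intro ξ η
    have := alternating_swap (σ u) ξ η
    rwa [hval, hval] at this

/-- A linear map of rank `k` has a `k`-dimensional restriction with a left inverse. -/
theorem exists_frame [FiniteDimensional ℝ E] {Q : G →L[ℝ] E} {k : ℕ}
    (hk : finrank ℝ Q.toLinearMap.range = k) :
    ∃ (e : EuclideanSpace ℝ (Fin k) →L[ℝ] G) (p : E →L[ℝ] EuclideanSpace ℝ (Fin k)),
      p ∘L Q ∘L e = .id ℝ _ := by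
  let ι : EuclideanSpace ℝ (Fin k) ≃ₗ[ℝ] Q.toLinearMap.range :=
    LinearEquiv.ofFinrankEq _ _ (by simp [hk])
  let D : EuclideanSpace ℝ (Fin k) →L[ℝ] E :=
    (Q.toLinearMap.range.subtype ∘ₗ ι.toLinearMap).toContinuousLinearMap
  have hD : Function.Injective D := Subtype.val_injective.comp ι.injective
  obtain ⟨p, hp⟩ := exists_clm_leftInverse hD
  obtain ⟨e, he⟩ := exists_clm_lift (D := D) (Q := Q) (fun ξ ↦ (ι ξ).2)
  exact ⟨e, p, by rw [he, hp]⟩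

theorem le_finrank_range_of_isInvertible [FiniteDimensional ℝ E] {k : ℕ} {Q : G →L[ℝ] E}
    {e : EuclideanSpace ℝ (Fin k) →L[ℝ] G} {p : E →L[ℝ] EuclideanSpace ℝ (Fin k)}
    (h : (p ∘L Q ∘L e).IsInvertible) : k ≤ finrank ℝ Q.toLinearMap.range := by
  have hinj : Function.Injective (Q.toLinearMap.rangeRestrict ∘ₗ e.toLinearMap) := by
    intro ξ η hξη
    exact h.injective (congrArg (fun v ↦ p v.1) hξη)
  simpa using LinearMap.finrank_le_finrank_of_injective hinj

/-- Q ∘ e is injective into a space of its own dimension `k`, hence onto it. -/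
theorem range_comp_eq_of_isInvertible [FiniteDimensional ℝ E] {k : ℕ} {Q : G →L[ℝ] E}
    {e : EuclideanSpace ℝ (Fin k) →L[ℝ] G} {p : E →L[ℝ] EuclideanSpace ℝ (Fin k)}
    (h : (p ∘L Q ∘L e).IsInvertible) (hk : finrank ℝ Q.toLinearMap.range = k) (a : G) :
    ∃ ξ, Q (e ξ) = Q a := by
  have hinj : Function.Injective (Q.toLinearMap.rangeRestrict ∘ₗ e.toLinearMap) := by
    intro ξ η hξη
    exact h.injective (congrArg (fun v ↦ p v.1) hξη)
  obtain ⟨ξ, hξ⟩ := (LinearMap.injective_iff_surjective_of_finrank_eq_finrank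
    (by simp [hk])).1 hinj (Q.toLinearMap.rangeRestrict a)
  exact ⟨ξ, congrArg Subtype.val hξ⟩

/-- Lower semicontinuity of the rank: a maximal minor p ∘ Q ∘ e that is invertible at `z₀` stays
invertible nearby. -/
theorem eventually_le_finrank_range [FiniteDimensional ℝ E] {Y : Type*} [TopologicalSpace Y]
    {Q : Y → G →L[ℝ] E} {z₀ : Y} (hQ : ContinuousAt Q z₀) :
    ∀ᶠ z in 𝓝 z₀, finrank ℝ (Q z₀).toLinearMap.range ≤ finrank ℝ (Q z).toLinearMap.range := by
  obtain ⟨e, p, hep⟩ := exists_frame (Q := Q z₀) rfl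
  have hN : ContinuousAt (fun z ↦ p ∘L Q z ∘L e) z₀ :=
    continuousAt_const.clm_comp (hQ.clm_comp continuousAt_const)
  filter_upwards [eventually_isInvertible hN hep] with z hz
  exact le_finrank_range_of_isInvertible hz

/-- **Frobenius theorem**: the ranges of an involutive smooth family of linear maps of constant
rank `k` are the tangent spaces of immersed `k`-dimensional balls. -/
theorem exists_integral_immersion [FiniteDimensional ℝ E] {Q : E → G →L[ℝ] E} {S : Set E}
    (hS : IsOpen S) (hQ : ContDiffOn ℝ ∞ Q S) {k : ℕ}
    (hk : ∀ z ∈ S, finrank ℝ (Q z).toLinearMap.range = k)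
    (hinv : ∀ z ∈ S, ∀ a b, ∃ w, fderiv ℝ Q z (Q z a) b - fderiv ℝ Q z (Q z b) a = Q z w)
    {z₀ : E} (hz₀ : z₀ ∈ S) :
    ∃ δ > 0, ∃ c : EuclideanSpace ℝ (Fin k) → E, c 0 = z₀ ∧ MapsTo c (Metric.ball 0 δ) S ∧
      ContDiffOn ℝ ∞ c (Metric.ball 0 δ) ∧ InjOn c (Metric.ball 0 δ) ∧
      ∀ s ∈ Metric.ball 0 δ, Function.Injective (fderiv ℝ c s) ∧
        (fderiv ℝ c s).toLinearMap.range = (Q (c s)).toLinearMap.range := by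
  obtain ⟨e, p, hep⟩ := exists_frame (hk z₀ hz₀)
  set N : E → EuclideanSpace ℝ (Fin k) →L[ℝ] EuclideanSpace ℝ (Fin k) :=
    fun z ↦ p ∘L Q z ∘L e with hN
  have hNc : ContDiffOn ℝ ∞ N S := contDiffOn_const.clm_comp (hQ.clm_comp contDiffOn_const)
  have hNinv : ∀ᶠ z in 𝓝 z₀, (N z).IsInvertible :=
    eventually_isInvertible (hNc.continuousOn.continuousAt (hS.mem_nhds hz₀)) hep
  obtain ⟨T, hT, hTo, hzT⟩ := eventually_nhds_iff.1 (hNinv.and (hS.eventually_mem hz₀))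
  -- Normalizes the frame: B = Q ∘ g has the same range as `Q` and satisfies p ∘ B = id, as if its
  -- range were the graph over coordinates selected by `p`.
  set g : E → EuclideanSpace ℝ (Fin k) →L[ℝ] G := fun z ↦ e ∘L (N z).inverse with hg
  have hgc : ContDiffOn ℝ ∞ g T := fun z hz ↦ (contDiffAt_const.clm_comp
    (contDiffAt_inverse_of_isInvertible (hNc.contDiffAt (hS.mem_nhds (hT z hz).2))
      (hT z hz).1)).contDiffWithinAt
  set B : E → EuclideanSpace ℝ (Fin k) →L[ℝ] E := fun z ↦ Q z ∘L g z with hB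
  have hBc : ContDiffOn ℝ ∞ B T := (hQ.mono fun z hz ↦ (hT z hz).2).clm_comp hgc
  have hpB : ∀ z ∈ T, ∀ ξ, p (B z ξ) = ξ := fun z hz ξ ↦ (hT z hz).1.self_apply_inverse ξ
  have hrange : ∀ z ∈ T, ∀ a, ∃ ξ, B z ξ = Q z a := by
    intro z hz a
    obtain ⟨ξ, hξ⟩ := range_comp_eq_of_isInvertible (hT z hz).1 (hk z (hT z hz).2) a
    refine ⟨N z ξ, ?_⟩
    simp only [hB, hg, ContinuousLinearMap.comp_apply, (hT z hz).1.inverse_apply_self, hξ]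
  -- The bracket of two frame fields Bξ, Bη lies in the range of `B` by involutivity. It is also
  -- killed by `p`, since pBξ and pBη are constant. As `p` is injective on that range, the frame
  -- fields commute.
  have hsymm : ∀ z ∈ T, ∀ ξ η, fderiv ℝ B z (B z ξ) η = fderiv ℝ B z (B z η) ξ := by
    intro z hz ξ η
    have hBd : HasFDerivAt B (fderiv ℝ B z) z :=
      ((hBc.contDiffAt (hTo.mem_nhds hz)).differentiableAt (by simp)).hasFDerivAt
    have hQd : HasFDerivAt Q (fderiv ℝ Q z) z :=
      ((hQ.contDiffAt (hS.mem_nhds (hT z hz).2)).differentiableAt (by simp)).hasFDerivAt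
    have hgd : HasFDerivAt g (fderiv ℝ g z) z :=
      ((hgc.contDiffAt (hTo.mem_nhds hz)).differentiableAt (by simp)).hasFDerivAt
    have hformula (v : E) (ζ : EuclideanSpace ℝ (Fin k)) :
        fderiv ℝ B z v ζ = fderiv ℝ Q z v (g z ζ) + Q z (fderiv ℝ g z v ζ) := by
      rw [(hQd.clm_comp hgd).fderiv]
      simp [add_comm]
    have hzero (v : E) (ζ : EuclideanSpace ℝ (Fin k)) : p (fderiv ℝ B z v ζ) = 0 := by
      have h1 : HasFDerivAt (fun y ↦ p (B y ζ)) (p ∘L (fderiv ℝ B z).flip ζ) z := by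
        refine p.hasFDerivAt.comp z ?_
        simpa using hBd.clm_apply (hasFDerivAt_const ζ z)
      have h2 : (fun y ↦ p (B y ζ)) =ᶠ[𝓝 z] fun _ ↦ ζ := by
        filter_upwards [hTo.mem_nhds hz] with y hy
        exact hpB y hy ζ
      have h3 := h1.unique ((hasFDerivAt_const ζ z).congr_of_eventuallyEq h2)
      exact DFunLike.congr_fun h3 v
    obtain ⟨w, hw⟩ := hinv z (hT z hz).2 (g z ξ) (g z η)
    obtain ⟨χ, hχ⟩ := hrange z hz
      (w + (fderiv ℝ g z (B z ξ) η - fderiv ℝ g z (B z η) ξ))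
    have hdiff : fderiv ℝ B z (B z ξ) η - fderiv ℝ B z (B z η) ξ = B z χ := by
      rw [hχ, map_add, map_sub, ← hw, hformula, hformula]
      simp only [hB, ContinuousLinearMap.comp_apply]
      abel
    have hχ0 : χ = 0 := by
      rw [← hpB z hz χ, ← hdiff, map_sub, hzero, hzero, sub_zero]
    rw [← sub_eq_zero, hdiff, hχ0, map_zero]
  obtain ⟨δ, hδ, c, hc0, hcT, hcd, hcc⟩ := exists_hasFDerivAt_eq_comp hTo hBc hsymm hzT
  refine ⟨δ, hδ, c, hc0, fun s hs ↦ (hT _ (hcT s hs)).2, hcc, ?_, fun s hs ↦ ⟨?_, ?_⟩⟩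
  · have hpc : ∀ s ∈ Metric.ball (0 : EuclideanSpace ℝ (Fin k)) δ, p (c s) - s = p z₀ := by
      have h1 : ∀ s ∈ Metric.ball (0 : EuclideanSpace ℝ (Fin k)) δ,
          HasFDerivWithinAt (fun s ↦ p (c s) - s)
            (0 : EuclideanSpace ℝ (Fin k) →L[ℝ] EuclideanSpace ℝ (Fin k)) (Metric.ball 0 δ) s := by
        intro s hs
        have h2 := (p.hasFDerivAt.comp s (hcd s hs)).sub (hasFDerivAt_id s)
        have h3 : p ∘L B (c s) - .id ℝ _ = 0 := by
          ext1 ξ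
          simp [hpB _ (hcT s hs)]
        rw [h3] at h2
        exact h2.hasFDerivWithinAt
      intro s hs
      have h4 := (convex_ball (0 : EuclideanSpace ℝ (Fin k)) δ).is_const_of_fderivWithin_eq_zero
        (𝕜 := ℝ) (f := fun s ↦ p (c s) - s) (fun s hs ↦ (h1 s hs).differentiableWithinAt)
        (fun s hs ↦ (h1 s hs).fderivWithin (Metric.isOpen_ball.uniqueDiffWithinAt hs)) hs
        (Metric.mem_ball_self hδ)
      simpa [hc0] using h4
    intro s hs t ht hst
    have h5 := (hpc s hs).trans (hpc t ht).symm
    rw [hst] at h5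
    exact sub_right_injective h5
  · rw [(hcd s hs).fderiv]
    intro ξ η h
    rw [← hpB _ (hcT s hs) ξ, h, hpB _ (hcT s hs)]
  · rw [(hcd s hs).fderiv]
    apply le_antisymm
    · rintro _ ⟨ξ, rfl⟩
      exact ⟨g (c s) ξ, rfl⟩
    · rintro _ ⟨a, rfl⟩
      exact hrange _ (hcT s hs) a

end LocalInverse

/-! ### Tangent and cotangent vectors in a chart. -/

section Charts

open Set Module

variable {E : Type*} [NormedAddCommGroup E] [NormedSpace ℝ E]
  {M : Type*} [TopologicalSpace M] [ChartedSpace E M] [IsManifold 𝓘(ℝ, E) ∞ M]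

instance : IsManifold 𝓘(ℝ, E) 1 M := .of_le (n := ∞) (by exact_mod_cast le_top)

/-- The differential at `y` of the chart at `x₀`. -/
def toModel (x₀ y : M) : Tangent E y →L[ℝ] E :=
  (trivializationAt E (TangentSpace 𝓘(ℝ, E)) x₀).continuousLinearMapAt ℝ y

/-- The inverse of the differential at `y` of the chart at `x₀`. -/
def ofModel (x₀ y : M) : E →L[ℝ] Tangent E y :=
  (trivializationAt E (TangentSpace 𝓘(ℝ, E)) x₀).symmL ℝ y

variable {x₀ y : M}

theorem ofModel_toModel (hy : y ∈ (chartAt E x₀).source) (v : Tangent E y) :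
    ofModel x₀ y (toModel x₀ y v) = v :=
  (trivializationAt E (TangentSpace 𝓘(ℝ, E)) x₀).symmL_continuousLinearMapAt (by simpa) v

theorem toModel_ofModel (hy : y ∈ (chartAt E x₀).source) (v : E) :
    toModel x₀ y (ofModel x₀ y v) = v :=
  (trivializationAt E (TangentSpace 𝓘(ℝ, E)) x₀).continuousLinearMapAt_symmL (by simpa) v

theorem toModel_eq_mfderiv (hy : y ∈ (chartAt E x₀).source) :
    toModel (E := E) x₀ y = mfderiv 𝓘(ℝ, E) 𝓘(ℝ, E) (extChartAt 𝓘(ℝ, E) x₀) y :=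
  TangentBundle.continuousLinearMapAt_trivializationAt hy

theorem ofModel_eq_mfderiv {z : E} (hz : z ∈ (extChartAt 𝓘(ℝ, E) x₀).target) :
    ofModel (E := E) x₀ ((extChartAt 𝓘(ℝ, E) x₀).symm z) =
      mfderiv 𝓘(ℝ, E) 𝓘(ℝ, E) (extChartAt 𝓘(ℝ, E) x₀).symm z := by
  have hy : (extChartAt 𝓘(ℝ, E) x₀).symm z ∈ (chartAt E x₀).source := by
    simpa only [extChartAt_source] using (extChartAt 𝓘(ℝ, E) x₀).map_target hz
  have := TangentBundle.symmL_trivializationAt (𝕜 := ℝ) (I := 𝓘(ℝ, E)) hy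
  rw [(extChartAt 𝓘(ℝ, E) x₀).right_inv hz] at this
  refine this.trans ?_
  rw [ModelWithCorners.range_eq_univ, mfderivWithin_univ]

theorem contMDiffAt_covector_iff {α : ∀ x : M, Cotangent E x} (hy : y ∈ (chartAt E x₀).source) :
    ContMDiffAt 𝓘(ℝ, E) (𝓘(ℝ, E).prod 𝓘(ℝ, E →L[ℝ] ℝ)) ∞
      (fun x ↦ TotalSpace.mk' (E →L[ℝ] ℝ) (E := fun y : M ↦ Cotangent E y) x (α x)) y ↔
    ContMDiffAt 𝓘(ℝ, E) 𝓘(ℝ, E →L[ℝ] ℝ) ∞ (fun x ↦ α x ∘L ofModel x₀ x) y := by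
  rw [(trivializationAt (E →L[ℝ] ℝ) (fun y : M ↦ Cotangent E y) x₀).contMDiffAt_section_iff
    (by simpa [hom_trivializationAt_baseSet] using hy)]
  refine iff_of_eq (congrArg (fun f ↦ ContMDiffAt 𝓘(ℝ, E) 𝓘(ℝ, E →L[ℝ] ℝ) ∞ f y) ?_)
  funext x
  simp only [hom_trivializationAt_apply, ContinuousLinearMap.inCoordinates]
  ext v
  simp [ofModel]

theorem contMDiffAt_vector_iff {X : ∀ x : M, Tangent E x} (hy : y ∈ (chartAt E x₀).source) :
    ContMDiffAt 𝓘(ℝ, E) 𝓘(ℝ, E).tangent ∞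
      (fun x ↦ TotalSpace.mk' E (E := fun y : M ↦ Tangent E y) x (X x)) y ↔
    ContMDiffAt 𝓘(ℝ, E) 𝓘(ℝ, E) ∞ (fun x ↦ toModel x₀ x (X x)) y := by
  have h1 := (trivializationAt E (TangentSpace 𝓘(ℝ, E)) x₀).contMDiffAt_section_iff
    (n := ∞) (IB := 𝓘(ℝ, E)) (s := X) (x₀ := y) (by simpa using hy)
  refine h1.trans (Filter.EventuallyEq.contMDiffAt_iff ?_)
  filter_upwards [(chartAt E x₀).open_source.mem_nhds hy] with x hx
  exact (Trivialization.continuousLinearMapAt_apply_of_mem _ _ (by simpa) _).symm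

end Charts

/-! ### The bivector field in a chart. -/

section LocalSharp

open Set Module

theorem contDiffOn_of_forall_apply {E G X : Type*} [NormedAddCommGroup E] [NormedSpace ℝ E]
    [FiniteDimensional ℝ E] [NormedAddCommGroup G] [NormedSpace ℝ G] [FiniteDimensional ℝ G]
    [NormedAddCommGroup X] [NormedSpace ℝ X] {n : WithTop ℕ∞} {Q : X → G →L[ℝ] E} {S : Set X}
    (h : ∀ (a : G) (b : E →L[ℝ] ℝ), ContDiffOn ℝ n (fun z ↦ b (Q z a)) S) :
    ContDiffOn ℝ n Q S := by
  rw [contDiffOn_clm_apply]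
  intro a
  let b := finBasis ℝ E
  have h1 : (fun z ↦ Q z a) = fun z ↦ ∑ i, (b.coord i).toContinuousLinearMap (Q z a) • b i := by
    funext z
    exact (b.sum_repr (Q z a)).symm
  rw [h1]
  exact ContDiffOn.sum fun i _ ↦ (h a _).smul contDiffOn_const

variable {E : Type*} [NormedAddCommGroup E] [NormedSpace ℝ E]
  {M : Type*} [TopologicalSpace M] [ChartedSpace E M] [IsManifold 𝓘(ℝ, E) ∞ M]

variable {x₀ y : M}

/-- The covector at `y` with coordinates `a` in the chart at `x₀`. -/
def covector (x₀ y : M) (a : E →L[ℝ] ℝ) : Cotangent E y := a ∘L toModel x₀ y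

theorem covector_comp_ofModel (hy : y ∈ (chartAt E x₀).source)
    (v : Cotangent E y) : covector x₀ y (v ∘L ofModel x₀ y) = v := by
  ext w
  exact congrArg v (ofModel_toModel hy w)

theorem contMDiffAt_covector {κ : M → E →L[ℝ] ℝ}
    (hy : y ∈ (chartAt E x₀).source) (hκ : ContMDiffAt 𝓘(ℝ, E) 𝓘(ℝ, E →L[ℝ] ℝ) ∞ κ y) :
    ContMDiffAt 𝓘(ℝ, E) (𝓘(ℝ, E).prod 𝓘(ℝ, E →L[ℝ] ℝ)) ∞
      (fun x ↦ TotalSpace.mk' (E →L[ℝ] ℝ) (E := fun y : M ↦ Cotangent E y) x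
        (covector x₀ x (κ x))) y := by
  rw [contMDiffAt_covector_iff hy]
  refine hκ.congr_of_eventuallyEq ?_
  filter_upwards [(chartAt E x₀).open_source.mem_nhds hy] with x hx
  ext v
  exact congrArg (κ x) (toModel_ofModel hx v)

variable [FiniteDimensional ℝ E]

namespace Bivector

variable (Θ : Bivector E M) (x₀ : M) {y : M} {z : E}

/-- The homomorphism `Θ_y` in the coordinates of the chart at `x₀`. -/
def sharpAt (y : M) : (E →L[ℝ] ℝ) →L[ℝ] E :=
  LinearMap.toContinuousLinearMap
    { toFun := fun a ↦ toModel x₀ y (Θ.sharp y (covector x₀ y a))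
      map_add' := fun a b ↦ by
        rw [← map_add, ← map_add]
        congr 2
      map_smul' := fun r a ↦ by
        rw [RingHom.id_apply, ← map_smul, ← map_smul]
        congr 2 }

theorem sharpAt_apply (y : M) (a : E →L[ℝ] ℝ) :
    Θ.sharpAt x₀ y a = toModel x₀ y (Θ.sharp y (covector x₀ y a)) := rfl

theorem apply_sharpAt (y : M) (a b : E →L[ℝ] ℝ) :
    b (Θ.sharpAt x₀ y a) = Θ.toFun y (covector x₀ y a) (covector x₀ y b) :=
  Θ.apply_sharp y (covector x₀ y a) (covector x₀ y b)

theorem sharpAt_skew (y : M) (a b : E →L[ℝ] ℝ) :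
    b (Θ.sharpAt x₀ y a) = -a (Θ.sharpAt x₀ y b) := by
  have := Θ.apply_sharp_add y (covector x₀ y a) (covector x₀ y b)
  rw [apply_sharp, apply_sharp] at this
  rw [apply_sharpAt, apply_sharpAt]
  linarith

variable {x₀}

theorem sharp_eq (hy : y ∈ (chartAt E x₀).source) (v : Cotangent E y) :
    Θ.sharp y v = ofModel x₀ y (Θ.sharpAt x₀ y (v ∘L ofModel x₀ y)) := by
  rw [sharpAt_apply, ofModel_toModel hy, covector_comp_ofModel hy]

/-- The homomorphism `Θ` in the coordinates of the chart at `x₀`, as a function on the model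
space. -/
def localSharp (x₀ : M) (z : E) : (E →L[ℝ] ℝ) →L[ℝ] E :=
  Θ.sharpAt x₀ ((extChartAt 𝓘(ℝ, E) x₀).symm z)

theorem localSharp_extChartAt (hy : y ∈ (chartAt E x₀).source) :
    Θ.localSharp x₀ (extChartAt 𝓘(ℝ, E) x₀ y) = Θ.sharpAt x₀ y := by
  rw [localSharp, (extChartAt 𝓘(ℝ, E) x₀).left_inv (by rwa [extChartAt_source])]

theorem contMDiffAt_apply_sharpAt (hy : y ∈ (chartAt E x₀).source) (a b : E →L[ℝ] ℝ) :
    ContMDiffAt 𝓘(ℝ, E) 𝓘(ℝ, ℝ) ∞ (fun y ↦ b (Θ.sharpAt x₀ y a)) y := by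
  have hc (a : E →L[ℝ] ℝ) := contMDiffAt_covector (κ := fun _ ↦ a) hy contMDiffAt_const
  have h1 := ContMDiffAt.clm_bundle_apply (F₁ := E →L[ℝ] ℝ) (F₂ := (E →L[ℝ] ℝ) →L[ℝ] ℝ)
    (E₁ := fun y : M ↦ Cotangent E y) (E₂ := fun y : M ↦ Cotangent E y →L[ℝ] ℝ)
    (b := fun y : M ↦ y) (Θ.smooth y) (hc a)
  have h2 := ContMDiffAt.clm_bundle_apply (F₁ := E →L[ℝ] ℝ) (F₂ := ℝ)
    (E₁ := fun y : M ↦ Cotangent E y) (E₂ := fun _ : M ↦ ℝ) (b := fun y : M ↦ y) h1 (hc b)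
  have h3 := (contMDiffAt_section (F := ℝ) (E := fun _ : M ↦ ℝ) y).1 h2
  refine h3.congr_of_eventuallyEq (Filter.Eventually.of_forall fun x ↦ ?_)
  exact Θ.apply_sharpAt x₀ x a b

theorem contDiffOn_localSharp (x₀ : M) :
    ContDiffOn ℝ ∞ (Θ.localSharp x₀) (extChartAt 𝓘(ℝ, E) x₀).target := by
  refine contDiffOn_of_forall_apply fun a b z hz ↦ ?_
  have hy : (extChartAt 𝓘(ℝ, E) x₀).symm z ∈ (chartAt E x₀).source := by
    simpa only [extChartAt_source] using (extChartAt 𝓘(ℝ, E) x₀).map_target hz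
  have h1 := (Θ.contMDiffAt_apply_sharpAt hy a b).comp z
    ((contMDiffOn_extChartAt_symm x₀).contMDiffAt ((isOpen_extChartAt_target x₀).mem_nhds hz))
  exact h1.contDiffAt.contDiffWithinAt

theorem localSharp_skew (x₀ : M) (z : E) (a b : E →L[ℝ] ℝ) :
    b (Θ.localSharp x₀ z a) = -a (Θ.localSharp x₀ z b) := Θ.sharpAt_skew x₀ _ a b

theorem map_image (hy : y ∈ (chartAt E x₀).source) (v : Tangent E y) :
    v ∈ Θ.image y ↔ ∃ a, Θ.sharpAt x₀ y a = toModel x₀ y v := by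
  constructor
  · rintro ⟨w, rfl⟩
    refine ⟨w ∘L ofModel x₀ y, ?_⟩
    rw [sharpAt_apply, covector_comp_ofModel hy]
  · rintro ⟨a, ha⟩
    refine ⟨covector x₀ y a, ?_⟩
    rw [← ofModel_toModel hy (Θ.sharp y _), ← sharpAt_apply, ha, ofModel_toModel hy]

theorem finrank_image (hy : y ∈ (chartAt E x₀).source) :
    finrank ℝ (Θ.image y) = finrank ℝ (Θ.sharpAt x₀ y).toLinearMap.range := by
  have h : (Θ.sharpAt x₀ y).toLinearMap.range = (Θ.image y).map (toModel x₀ y).toLinearMap := by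
    ext w
    constructor
    · rintro ⟨a, rfl⟩
      exact ⟨_, ⟨covector x₀ y a, rfl⟩, rfl⟩
    · rintro ⟨v, hv, rfl⟩
      exact (Θ.map_image hy v).1 hv
  have hinj : Function.Injective (toModel x₀ y).toLinearMap :=
    Function.LeftInverse.injective (ofModel_toModel hy)
  rw [h]
  exact ((Submodule.equivMapOfInjective _ hinj _).finrank_eq)

end Bivector

end LocalSharp

/-! ### The Jacobi identity in charts. -/

section Jacobi

open Set Module

variable {E : Type*} [NormedAddCommGroup E] [NormedSpace ℝ E]
  {M : Type*} [TopologicalSpace M] [ChartedSpace E M]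

theorem symm_mem_chart_source {x₀ : M} {z : E} (hz : z ∈ (extChartAt 𝓘(ℝ, E) x₀).target) :
    (extChartAt 𝓘(ℝ, E) x₀).symm z ∈ (chartAt E x₀).source := by
  simpa only [extChartAt_source] using (extChartAt 𝓘(ℝ, E) x₀).map_target hz

variable [IsManifold 𝓘(ℝ, E) ∞ M] {x₀ : M} {z : E}

theorem contMDiffAt_extChartAt_symm_of_mem (hz : z ∈ (extChartAt 𝓘(ℝ, E) x₀).target) :
    ContMDiffAt 𝓘(ℝ, E) 𝓘(ℝ, E) ∞ (extChartAt 𝓘(ℝ, E) x₀).symm z :=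
  (contMDiffOn_extChartAt_symm x₀).contMDiffAt ((isOpen_extChartAt_target x₀).mem_nhds hz)

theorem mvfderiv_eq_covector (hz : z ∈ (extChartAt 𝓘(ℝ, E) x₀).target) {f : M → ℝ}
    (hf : MDifferentiableAt 𝓘(ℝ, E) 𝓘(ℝ, ℝ) f ((extChartAt 𝓘(ℝ, E) x₀).symm z)) :
    mvfderiv 𝓘(ℝ, E) f ((extChartAt 𝓘(ℝ, E) x₀).symm z) =
      covector x₀ _ (fderiv ℝ (f ∘ (extChartAt 𝓘(ℝ, E) x₀).symm) z) := by
  have h1 := mvfderiv_comp z hf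
    ((contMDiffAt_extChartAt_symm_of_mem hz).mdifferentiableAt (by simp))
  rw [← ofModel_eq_mfderiv hz] at h1
  have h2 : fderiv ℝ (f ∘ (extChartAt 𝓘(ℝ, E) x₀).symm) z =
      (mvfderiv 𝓘(ℝ, E) f ((extChartAt 𝓘(ℝ, E) x₀).symm z)).comp
        (ofModel (E := E) x₀ ((extChartAt 𝓘(ℝ, E) x₀).symm z)) := by
    refine Eq.trans ?_ h1
    ext v
    rw [mvfderiv, mfderiv_eq_fderiv]
    rfl
  rw [h2, covector_comp_ofModel (symm_mem_chart_source hz)]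

/-- Every linear function in a chart agrees near a given point with a smooth function on the
manifold. -/
theorem exists_contMDiff_eventuallyEq [FiniteDimensional ℝ E] [T2Space M]
    (hz : z ∈ (extChartAt 𝓘(ℝ, E) x₀).target) (a : E →L[ℝ] ℝ) :
    ∃ f : M → ℝ, ContMDiff 𝓘(ℝ, E) 𝓘(ℝ, ℝ) ∞ f ∧ f ∘ (extChartAt 𝓘(ℝ, E) x₀).symm =ᶠ[𝓝 z] a := by
  have hy := symm_mem_chart_source hz
  obtain ⟨ψ, -, hψ⟩ := (SmoothBumpFunction.nhds_basis_tsupport (I := 𝓘(ℝ, E))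
    ((extChartAt 𝓘(ℝ, E) x₀).symm z)).mem_iff.1 ((chartAt E x₀).open_source.mem_nhds hy)
  refine ⟨fun y ↦ ψ y * a (extChartAt 𝓘(ℝ, E) x₀ y), contMDiff_of_tsupport fun y hy' ↦ ?_, ?_⟩
  · have h1 : y ∈ (chartAt E x₀).source := hψ (closure_mono (fun x hx ↦ left_ne_zero_of_mul hx) hy')
    have h2 : ContMDiffAt 𝓘(ℝ, E) 𝓘(ℝ, E) ∞ (extChartAt 𝓘(ℝ, E) x₀) y :=
      contMDiffOn_extChartAt.contMDiffAt ((chartAt E x₀).open_source.mem_nhds h1)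
    exact ψ.contMDiffAt.mul (a.contMDiff.contMDiffAt.comp y h2)
  · have h1 := (contMDiffAt_extChartAt_symm_of_mem hz).continuousAt.eventually ψ.eventuallyEq_one
    filter_upwards [h1, (isOpen_extChartAt_target x₀).mem_nhds hz] with w h2 h3
    rw [Function.comp_apply, h2, (extChartAt 𝓘(ℝ, E) x₀).right_inv h3, Pi.one_apply, one_mul]

theorem contDiffAt_comp_extChartAt_symm {f : M → ℝ}
    (hf : ContMDiff 𝓘(ℝ, E) 𝓘(ℝ, ℝ) ∞ f) (hz : z ∈ (extChartAt 𝓘(ℝ, E) x₀).target) :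
    ContDiffAt ℝ ∞ (f ∘ (extChartAt 𝓘(ℝ, E) x₀).symm) z :=
  (hf.contMDiffAt.comp z (contMDiffAt_extChartAt_symm_of_mem hz)).contDiffAt

variable [FiniteDimensional ℝ E]

namespace Bivector

variable (Θ : Bivector E M)

theorem bracket_symm_apply (hz : z ∈ (extChartAt 𝓘(ℝ, E) x₀).target) {f g : M → ℝ}
    (hf : MDifferentiableAt 𝓘(ℝ, E) 𝓘(ℝ, ℝ) f ((extChartAt 𝓘(ℝ, E) x₀).symm z))
    (hg : MDifferentiableAt 𝓘(ℝ, E) 𝓘(ℝ, ℝ) g ((extChartAt 𝓘(ℝ, E) x₀).symm z)) :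
    Θ.bracket f g ((extChartAt 𝓘(ℝ, E) x₀).symm z) =
      fderiv ℝ (g ∘ (extChartAt 𝓘(ℝ, E) x₀).symm) z
        (Θ.localSharp x₀ z (fderiv ℝ (f ∘ (extChartAt 𝓘(ℝ, E) x₀).symm) z)) := by
  rw [localSharp, apply_sharpAt, bracket, mvfderiv_eq_covector hz hf, mvfderiv_eq_covector hz hg]

theorem contDiffAt_localSharp (hz : z ∈ (extChartAt 𝓘(ℝ, E) x₀).target) :
    ContDiffAt ℝ ∞ (Θ.localSharp x₀) z :=
  (Θ.contDiffOn_localSharp x₀).contDiffAt ((isOpen_extChartAt_target x₀).mem_nhds hz)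

theorem bracket_bracket_symm_apply (hz : z ∈ (extChartAt 𝓘(ℝ, E) x₀).target) {f g h : M → ℝ}
    (hf : ContMDiff 𝓘(ℝ, E) 𝓘(ℝ, ℝ) ∞ f) (hg : ContMDiff 𝓘(ℝ, E) 𝓘(ℝ, ℝ) ∞ g)
    (hh : ContMDiff 𝓘(ℝ, E) 𝓘(ℝ, ℝ) ∞ h) :
    Θ.bracket f (Θ.bracket g h) ((extChartAt 𝓘(ℝ, E) x₀).symm z) =
      fderiv ℝ (fun y ↦ fderiv ℝ (h ∘ (extChartAt 𝓘(ℝ, E) x₀).symm) y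
        (Θ.localSharp x₀ y (fderiv ℝ (g ∘ (extChartAt 𝓘(ℝ, E) x₀).symm) y))) z
        (Θ.localSharp x₀ z (fderiv ℝ (f ∘ (extChartAt 𝓘(ℝ, E) x₀).symm) z)) := by
  have hmd {f : M → ℝ} (hf : ContMDiff 𝓘(ℝ, E) 𝓘(ℝ, ℝ) ∞ f) (y : M) :
      MDifferentiableAt 𝓘(ℝ, E) 𝓘(ℝ, ℝ) f y := hf.contMDiffAt.mdifferentiableAt (by simp)
  set k : E → ℝ := fun y ↦ fderiv ℝ (h ∘ (extChartAt 𝓘(ℝ, E) x₀).symm) y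
        (Θ.localSharp x₀ y (fderiv ℝ (g ∘ (extChartAt 𝓘(ℝ, E) x₀).symm) y)) with hk
  have h1 : Θ.bracket g h ∘ (extChartAt 𝓘(ℝ, E) x₀).symm =ᶠ[𝓝 z] k := by
    filter_upwards [(isOpen_extChartAt_target x₀).mem_nhds hz] with w hw
    exact Θ.bracket_symm_apply hw (hmd hg _) (hmd hh _)
  have hkd : ContDiffAt ℝ ∞ k z :=
    ((contDiffAt_comp_extChartAt_symm hh hz).fderiv_right (m := ∞) (by simp)).clm_apply
      ((Θ.contDiffAt_localSharp hz).clm_apply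
        ((contDiffAt_comp_extChartAt_symm hg hz).fderiv_right (m := ∞) (by simp)))
  have hy := symm_mem_chart_source hz
  -- The chain rule for the outer bracket needs differentiability of the inner one on the manifold;
  -- near the point it is the smooth `k` composed with the chart.
  have h2 : MDifferentiableAt 𝓘(ℝ, E) 𝓘(ℝ, ℝ) (Θ.bracket g h)
      ((extChartAt 𝓘(ℝ, E) x₀).symm z) := by
    have h3 : ContMDiffAt 𝓘(ℝ, E) 𝓘(ℝ, E) ∞ (extChartAt 𝓘(ℝ, E) x₀)
        ((extChartAt 𝓘(ℝ, E) x₀).symm z) :=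
      contMDiffOn_extChartAt.contMDiffAt ((chartAt E x₀).open_source.mem_nhds hy)
    have h4 : ContMDiffAt 𝓘(ℝ, E) 𝓘(ℝ, ℝ) ∞ (k ∘ extChartAt 𝓘(ℝ, E) x₀)
        ((extChartAt 𝓘(ℝ, E) x₀).symm z) := by
      refine ContMDiffAt.comp _ ?_ h3
      rw [(extChartAt 𝓘(ℝ, E) x₀).right_inv hz]
      exact hkd.contMDiffAt
    refine (h4.congr_of_eventuallyEq ?_).mdifferentiableAt (by simp)
    filter_upwards [(chartAt E x₀).open_source.mem_nhds hy] with y hy'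
    have hy'' : y ∈ (extChartAt 𝓘(ℝ, E) x₀).source := by rwa [extChartAt_source]
    have h5 := Θ.bracket_symm_apply ((extChartAt 𝓘(ℝ, E) x₀).map_source hy'') (hmd hg _) (hmd hh _)
    rw [(extChartAt 𝓘(ℝ, E) x₀).left_inv hy''] at h5
    exact h5
  rw [Θ.bracket_symm_apply hz (hmd hf _) h2, h1.fderiv_eq]

/-- A bivector field is Poisson if and only if its Jacobiator vanishes in all charts. -/
theorem isPoisson_iff_jacobiator [T2Space M] :
    Θ.IsPoisson ↔ ∀ x₀ : M, ∀ z ∈ (extChartAt 𝓘(ℝ, E) x₀).target, ∀ a b c,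
      jacobiator (Θ.localSharp x₀) z a b c = 0 := by
  have key {x₀ : M} {z : E} (hz : z ∈ (extChartAt 𝓘(ℝ, E) x₀).target) {f₁ f₂ f₃ : M → ℝ}
      (h₁ : ContMDiff 𝓘(ℝ, E) 𝓘(ℝ, ℝ) ∞ f₁) (h₂ : ContMDiff 𝓘(ℝ, E) 𝓘(ℝ, ℝ) ∞ f₂)
      (h₃ : ContMDiff 𝓘(ℝ, E) 𝓘(ℝ, ℝ) ∞ f₃) :=
    cyclic_bracket_eq_jacobiator (Θ.localSharp_skew x₀ z)
      ((Θ.contDiffAt_localSharp hz).differentiableAt (by simp))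
      (mod_cast contDiffAt_infty.1 (contDiffAt_comp_extChartAt_symm h₁ hz) 2)
      (mod_cast contDiffAt_infty.1 (contDiffAt_comp_extChartAt_symm h₂ hz) 2)
      (mod_cast contDiffAt_infty.1 (contDiffAt_comp_extChartAt_symm h₃ hz) 2)
  constructor
  · intro hΘ x₀ z hz a b c
    -- Globally smooth functions that are linear in the chart near the point realize any three
    -- covectors as differentials.
    obtain ⟨f₁, h₁, e₁⟩ := exists_contMDiff_eventuallyEq hz a
    obtain ⟨f₂, h₂, e₂⟩ := exists_contMDiff_eventuallyEq hz b
    obtain ⟨f₃, h₃, e₃⟩ := exists_contMDiff_eventuallyEq hz c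
    have h := hΘ f₁ f₂ f₃ h₁ h₂ h₃ ((extChartAt 𝓘(ℝ, E) x₀).symm z)
    rw [Θ.bracket_bracket_symm_apply hz h₁ h₂ h₃, Θ.bracket_bracket_symm_apply hz h₂ h₃ h₁,
      Θ.bracket_bracket_symm_apply hz h₃ h₁ h₂, key hz h₁ h₂ h₃, e₁.fderiv_eq, e₂.fderiv_eq,
      e₃.fderiv_eq] at h
    simpa using h
  · intro hJ f₁ f₂ f₃ h₁ h₂ h₃ x
    have hz := mem_extChartAt_target (I := 𝓘(ℝ, E)) x
    have hx := extChartAt_to_inv (I := 𝓘(ℝ, E)) x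
    rw [← hx, Θ.bracket_bracket_symm_apply hz h₁ h₂ h₃, Θ.bracket_bracket_symm_apply hz h₂ h₃ h₁,
      Θ.bracket_bracket_symm_apply hz h₃ h₁ h₂, key hz h₁ h₂ h₃]
    exact hJ _ _ hz _ _ _

end Bivector

end Jacobi

/-! ### The Lie bracket in charts and closure of the image. -/

section Involutive

open Set Module

variable {E : Type*} [NormedAddCommGroup E] [NormedSpace ℝ E]
  {M : Type*} [TopologicalSpace M] [ChartedSpace E M]
variable [IsManifold 𝓘(ℝ, E) ∞ M] {x₀ : M} {z : E}

theorem minSmoothness_le_infty : minSmoothness ℝ 2 ≤ ∞ :=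
  minSmoothness_of_isRCLikeNormedField.le.trans (WithTop.coe_le_coe.2 (le_top : (2 : ℕ∞) ≤ ⊤))

instance : IsManifold 𝓘(ℝ, E) (minSmoothness ℝ 2) M :=
  .of_le (n := ∞) minSmoothness_le_infty

theorem inverse_mfderiv_extChartAt_symm (hz : z ∈ (extChartAt 𝓘(ℝ, E) x₀).target) :
    (mfderiv 𝓘(ℝ, E) 𝓘(ℝ, E) (extChartAt 𝓘(ℝ, E) x₀).symm z).inverse =
      toModel (E := E) x₀ ((extChartAt 𝓘(ℝ, E) x₀).symm z) := by
  have hy := symm_mem_chart_source hz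
  rw [← ofModel_eq_mfderiv hz]
  exact ContinuousLinearMap.inverse_eq
    (ContinuousLinearMap.ext fun v ↦ ofModel_toModel hy v)
    (ContinuousLinearMap.ext fun v ↦ toModel_ofModel hy v)

/-- The Lie bracket of vector fields in coordinates. -/
theorem toModel_mlieBracket [CompleteSpace E] (hz : z ∈ (extChartAt 𝓘(ℝ, E) x₀).target)
    {X Y : ∀ y : M, Tangent E y} {X' Y' : E → E}
    (hX : ContMDiffAt 𝓘(ℝ, E) 𝓘(ℝ, E).tangent ∞
      (fun x ↦ TotalSpace.mk' E (E := fun y : M ↦ Tangent E y) x (X x))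
      ((extChartAt 𝓘(ℝ, E) x₀).symm z))
    (hY : ContMDiffAt 𝓘(ℝ, E) 𝓘(ℝ, E).tangent ∞
      (fun x ↦ TotalSpace.mk' E (E := fun y : M ↦ Tangent E y) x (Y x))
      ((extChartAt 𝓘(ℝ, E) x₀).symm z))
    (hX' : ∀ᶠ w in 𝓝 z, toModel x₀ _ (X ((extChartAt 𝓘(ℝ, E) x₀).symm w)) = X' w)
    (hY' : ∀ᶠ w in 𝓝 z, toModel x₀ _ (Y ((extChartAt 𝓘(ℝ, E) x₀).symm w)) = Y' w) :
    toModel x₀ _ (VectorField.mlieBracket 𝓘(ℝ, E) X Y ((extChartAt 𝓘(ℝ, E) x₀).symm z)) =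
      VectorField.lieBracket ℝ X' Y' z := by
  -- Naturality of the Lie bracket under pullback along the inverse chart; on vectors this pullback
  -- is `toModel`.
  have h1 := VectorField.mpullback_mlieBracket (n := ∞) (hX.mdifferentiableAt (by simp))
    (hY.mdifferentiableAt (by simp)) (contMDiffAt_extChartAt_symm_of_mem hz)
    minSmoothness_le_infty
  have hev {X : ∀ y : M, Tangent E y} {X' : E → E}
      (hX' : ∀ᶠ w in 𝓝 z, toModel x₀ _ (X ((extChartAt 𝓘(ℝ, E) x₀).symm w)) = X' w) :
      VectorField.mpullback 𝓘(ℝ, E) 𝓘(ℝ, E) (extChartAt 𝓘(ℝ, E) x₀).symm X =ᶠ[𝓝 z] X' := by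
    filter_upwards [hX', (isOpen_extChartAt_target x₀).mem_nhds hz] with w h2 h3
    rw [VectorField.mpullback_apply, inverse_mfderiv_extChartAt_symm h3]
    exact h2
  rw [(hev hX').mlieBracket_vectorField_eq (hev hY'), VectorField.mpullback_apply,
    inverse_mfderiv_extChartAt_symm hz] at h1
  refine h1.trans ?_
  have h2 := VectorField.mlieBracketWithin_eq_lieBracketWithin (𝕜 := ℝ) (V := X') (W := Y')
    (s := univ)
  rw [VectorField.lieBracketWithin_univ] at h2
  exact congrFun h2 z

theorem SmoothOneFormOn.contDiffAt {α : ∀ x : M, Cotangent E x} {W : Set M}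
    (hα : SmoothOneFormOn α W) (hz : z ∈ (extChartAt 𝓘(ℝ, E) x₀).target)
    (hW : W ∈ 𝓝 ((extChartAt 𝓘(ℝ, E) x₀).symm z)) :
    ContDiffAt ℝ ∞ (fun w ↦ α ((extChartAt 𝓘(ℝ, E) x₀).symm w) ∘L ofModel x₀ _) z := by
  have h1 := (contMDiffAt_covector_iff (symm_mem_chart_source hz)).1 (hα.contMDiffAt hW)
  exact (h1.comp z (contMDiffAt_extChartAt_symm_of_mem hz)).contDiffAt

variable [FiniteDimensional ℝ E]

namespace Bivector

variable (Θ : Bivector E M)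

theorem toModel_sharp {y : M} (hy : y ∈ (chartAt E x₀).source) (v : Cotangent E y) :
    toModel x₀ y (Θ.sharp y v) = Θ.sharpAt x₀ y (v ∘L ofModel x₀ y) := by
  rw [sharp_eq Θ hy, toModel_ofModel hy]

theorem toModel_mlieBracket_sharp {α β : ∀ x : M, Cotangent E x} {X Y : ∀ y : M, Tangent E y}
    {W : Set M} (hα : SmoothOneFormOn α W) (hβ : SmoothOneFormOn β W)
    (hX : ∀ y ∈ W, X y = Θ.sharp y (α y)) (hY : ∀ y ∈ W, Y y = Θ.sharp y (β y))
    (hz : z ∈ (extChartAt 𝓘(ℝ, E) x₀).target)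
    (hW : W ∈ 𝓝 ((extChartAt 𝓘(ℝ, E) x₀).symm z)) {α' β' : E → E →L[ℝ] ℝ}
    (hα' : α' = fun w ↦ α ((extChartAt 𝓘(ℝ, E) x₀).symm w) ∘L ofModel x₀ _)
    (hβ' : β' = fun w ↦ β ((extChartAt 𝓘(ℝ, E) x₀).symm w) ∘L ofModel x₀ _) :
    toModel x₀ _ (VectorField.mlieBracket 𝓘(ℝ, E) X Y ((extChartAt 𝓘(ℝ, E) x₀).symm z)) =
      (fderiv ℝ (Θ.localSharp x₀) z (Θ.localSharp x₀ z (α' z)) (β' z) -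
        fderiv ℝ (Θ.localSharp x₀) z (Θ.localSharp x₀ z (β' z)) (α' z)) +
      Θ.localSharp x₀ z (fderiv ℝ β' z (Θ.localSharp x₀ z (α' z)) -
        fderiv ℝ α' z (Θ.localSharp x₀ z (β' z))) := by
  have hy := symm_mem_chart_source hz
  have hs := Θ.contDiffAt_localSharp hz
  have hloc {α : ∀ x : M, Cotangent E x} {X : ∀ y : M, Tangent E y} {α' : E → E →L[ℝ] ℝ}
      (hX : ∀ y ∈ W, X y = Θ.sharp y (α y))
      (hα' : α' = fun w ↦ α ((extChartAt 𝓘(ℝ, E) x₀).symm w) ∘L ofModel x₀ _) :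
      ∀ᶠ w in 𝓝 z, toModel x₀ _ (X ((extChartAt 𝓘(ℝ, E) x₀).symm w)) =
        Θ.localSharp x₀ w (α' w) := by
    filter_upwards [(contMDiffAt_extChartAt_symm_of_mem hz).continuousAt.eventually hW,
      (isOpen_extChartAt_target x₀).mem_nhds hz] with w h1 h2
    rw [hX _ h1, Θ.toModel_sharp (symm_mem_chart_source h2), hα']
    rfl
  have hd {α : ∀ x : M, Cotangent E x} (hα : SmoothOneFormOn α W) {α' : E → E →L[ℝ] ℝ}
      (hα' : α' = fun w ↦ α ((extChartAt 𝓘(ℝ, E) x₀).symm w) ∘L ofModel x₀ _) :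
      ContDiffAt ℝ ∞ α' z := by
    rw [hα']
    exact hα.contDiffAt hz hW
  have hsm {α : ∀ x : M, Cotangent E x} {X : ∀ y : M, Tangent E y}
      (hα : SmoothOneFormOn α W) {α' : E → E →L[ℝ] ℝ}
      (hX : ∀ y ∈ W, X y = Θ.sharp y (α y))
      (hα' : α' = fun w ↦ α ((extChartAt 𝓘(ℝ, E) x₀).symm w) ∘L ofModel x₀ _) :
      ContMDiffAt 𝓘(ℝ, E) 𝓘(ℝ, E).tangent ∞
        (fun x ↦ TotalSpace.mk' E (E := fun y : M ↦ Tangent E y) x (X x))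
        ((extChartAt 𝓘(ℝ, E) x₀).symm z) := by
    rw [contMDiffAt_vector_iff hy]
    have h1 : ContMDiffAt 𝓘(ℝ, E) 𝓘(ℝ, E) ∞
        ((fun w ↦ Θ.localSharp x₀ w (α' w)) ∘ extChartAt 𝓘(ℝ, E) x₀)
        ((extChartAt 𝓘(ℝ, E) x₀).symm z) := by
      refine ContMDiffAt.comp _ ?_
        (contMDiffOn_extChartAt.contMDiffAt ((chartAt E x₀).open_source.mem_nhds hy))
      rw [(extChartAt 𝓘(ℝ, E) x₀).right_inv hz]
      exact (hs.clm_apply (hd hα hα')).contMDiffAt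
    refine h1.congr_of_eventuallyEq ?_
    filter_upwards [hW, (chartAt E x₀).open_source.mem_nhds hy] with y h2 h3
    rw [hX _ h2, Θ.toModel_sharp h3, Function.comp_apply, Θ.localSharp_extChartAt h3, hα']
    simp only
    rw [(extChartAt 𝓘(ℝ, E) x₀).left_inv (by rwa [extChartAt_source])]
  have := FiniteDimensional.complete ℝ E
  rw [toModel_mlieBracket hz (hsm hα hX hα') (hsm hβ hY hβ') (hloc hX hα') (hloc hY hβ')]
  exact lieBracket_apply_field (hs.differentiableAt (by simp))
    ((hd hα hα').differentiableAt (by simp)) ((hd hβ hβ').differentiableAt (by simp))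

/-- The witness `κ` is the Koszul bracket of the two one-forms in coordinates. Vanishing of the
Jacobiator turns the frozen part of the Lie bracket into `Q` of its first summand; the other summand
comes from differentiating the coefficients. -/
theorem imageClosedUnderLieBracket_of_jacobiator
    (hJ : ∀ x₀ : M, ∀ z ∈ (extChartAt 𝓘(ℝ, E) x₀).target, ∀ a b c,
      jacobiator (Θ.localSharp x₀) z a b c = 0) : Θ.ImageClosedUnderLieBracket := by
  intro U hU X Y hX hY x hx
  obtain ⟨W₁, hW₁, hxW₁, hWU, α, hα, hXα⟩ := hX x hx
  obtain ⟨W₂, hW₂, hxW₂, -, β, hβ, hYβ⟩ := hY x hx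
  set Q := Θ.localSharp x with hQ
  set φ := extChartAt 𝓘(ℝ, E) x with hφ
  obtain ⟨α', hα'⟩ : ∃ α' : E → E →L[ℝ] ℝ, α' = fun w ↦ α (φ.symm w) ∘L ofModel x _ := ⟨_, rfl⟩
  obtain ⟨β', hβ'⟩ : ∃ β' : E → E →L[ℝ] ℝ, β' = fun w ↦ β (φ.symm w) ∘L ofModel x _ := ⟨_, rfl⟩
  have hα₂ : SmoothOneFormOn α (W₁ ∩ W₂) := hα.mono inter_subset_left
  have hβ₂ : SmoothOneFormOn β (W₁ ∩ W₂) := hβ.mono inter_subset_right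
  let κ : E → E →L[ℝ] ℝ := fun z ↦ β' z ∘L (fderiv ℝ Q z).flip (α' z) +
    (fderiv ℝ β' z (Q z (α' z)) - fderiv ℝ α' z (Q z (β' z)))
  refine ⟨W₁ ∩ W₂ ∩ (chartAt E x).source, (hW₁.inter hW₂).inter (chartAt E x).open_source,
    ⟨⟨hxW₁, hxW₂⟩, mem_chart_source E x⟩, fun y hy ↦ hWU hy.1.1,
    fun y ↦ covector x y (κ (φ y)), ?_, ?_⟩
  · rintro y ⟨hyW, hy⟩
    have hy' : y ∈ φ.source := by rwa [hφ, extChartAt_source]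
    have hz := φ.map_source hy'
    have hW : W₁ ∩ W₂ ∈ 𝓝 (φ.symm (φ y)) := by
      rw [φ.left_inv hy']
      exact (hW₁.inter hW₂).mem_nhds hyW
    have h1 : ContDiffAt ℝ ∞ α' (φ y) := by
      rw [hα']
      exact hα₂.contDiffAt hz hW
    have h2 : ContDiffAt ℝ ∞ β' (φ y) := by
      rw [hβ']
      exact hβ₂.contDiffAt hz hW
    have h3 : ContDiffAt ℝ ∞ Q (φ y) := Θ.contDiffAt_localSharp hz
    have hflip : ContDiffAt ℝ ∞ (fun z ↦ (fderiv ℝ Q z).flip) (φ y) :=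
      (ContinuousLinearMap.flipₗᵢ ℝ E (E →L[ℝ] ℝ) E).contDiff.contDiffAt.comp (φ y)
        (h3.fderiv_right (m := ∞) (by simp))
    have h4 : ContDiffAt ℝ ∞ κ (φ y) :=
      (h2.clm_comp (hflip.clm_apply h1)).add
        (((h2.fderiv_right (m := ∞) (by simp)).clm_apply (h3.clm_apply h1)).sub
          ((h1.fderiv_right (m := ∞) (by simp)).clm_apply (h3.clm_apply h2)))
    refine (contMDiffAt_covector hy ?_).contMDiffWithinAt
    exact h4.contMDiffAt.comp y
      (contMDiffOn_extChartAt.contMDiffAt ((chartAt E x).open_source.mem_nhds hy))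
  · rintro y ⟨hyW, hy⟩
    have hy' : y ∈ φ.source := by rwa [hφ, extChartAt_source]
    have hz := φ.map_source hy'
    have hW : W₁ ∩ W₂ ∈ 𝓝 (φ.symm (φ y)) := by
      rw [φ.left_inv hy']
      exact (hW₁.inter hW₂).mem_nhds hyW
    have h1 := Θ.toModel_mlieBracket_sharp hα₂ hβ₂ (fun y hy ↦ hXα y hy.1)
      (fun y hy ↦ hYβ y hy.2) hz hW hα' hβ'
    rw [fderiv_sub_fderiv_of_jacobiator_eq_zero (.of_forall fun w ↦ Θ.localSharp_skew x w)
      ((Θ.contDiffAt_localSharp hz).differentiableAt (by simp)) (hJ x _ hz), ← map_add,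
      φ.left_inv hy', Θ.localSharp_extChartAt hy, sharpAt_apply] at h1
    have h2 := congrArg (ofModel x y) h1
    rw [ofModel_toModel hy, ofModel_toModel hy] at h2
    have e : Q (φ y) = Θ.sharpAt x y := Θ.localSharp_extChartAt hy
    simp only [κ, e]
    exact h2

/-- If the image of `Θ` is closed under the Lie bracket, then the brackets of the fields that are
images of forms with constant coordinates have values in the image. -/
theorem ImageClosedUnderLieBracket.exists_eq {Θ : Bivector E M} (h : Θ.ImageClosedUnderLieBracket)
    (hz : z ∈ (extChartAt 𝓘(ℝ, E) x₀).target) (a b : E →L[ℝ] ℝ) :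
    ∃ w, fderiv ℝ (Θ.localSharp x₀) z (Θ.localSharp x₀ z a) b -
      fderiv ℝ (Θ.localSharp x₀) z (Θ.localSharp x₀ z b) a = Θ.localSharp x₀ z w := by
  have hy := symm_mem_chart_source hz
  have hsm (a : E →L[ℝ] ℝ) :
      SmoothOneFormOn (fun y : M ↦ covector x₀ y a) (chartAt E x₀).source :=
    fun y hy ↦ (contMDiffAt_covector (κ := fun _ ↦ a) hy contMDiffAt_const).contMDiffWithinAt
  have hsec (a : E →L[ℝ] ℝ) :
      Θ.IsImageSection (chartAt E x₀).source (fun y ↦ Θ.sharp y (covector x₀ y a)) :=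
    fun y hy ↦ ⟨_, (chartAt E x₀).open_source, hy, subset_rfl, _, hsm a, fun _ _ ↦ rfl⟩
  obtain ⟨W, -, hyW, -, γ, -, hγ⟩ :=
    h _ (chartAt E x₀).open_source _ _ (hsec a) (hsec b) _ hy
  have hcst (a : E →L[ℝ] ℝ) : (fun w : E ↦
      covector x₀ ((extChartAt 𝓘(ℝ, E) x₀).symm w) a ∘L ofModel (E := E) x₀ _) =ᶠ[𝓝 z]
      fun _ ↦ a := by
    filter_upwards [(isOpen_extChartAt_target x₀).mem_nhds hz] with w hw
    ext v
    exact congrArg a (toModel_ofModel (symm_mem_chart_source hw) v)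
  have h1 := Θ.toModel_mlieBracket_sharp (hsm a) (hsm b) (fun _ _ ↦ rfl) (fun _ _ ↦ rfl) hz
    ((chartAt E x₀).open_source.mem_nhds hy) rfl rfl
  have e := fun a ↦ (hcst a).self_of_nhds
  simp only at e
  rw [(hcst a).fderiv_eq, (hcst b).fderiv_eq, e a, e b] at h1
  -- The coefficients are constant in the chart, so only the frozen part of the bracket survives.
  simp only [fderiv_const_apply, zero_apply, sub_zero, map_zero, add_zero] at h1
  refine ⟨γ ((extChartAt 𝓘(ℝ, E) x₀).symm z) ∘L ofModel x₀ _, ?_⟩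
  exact h1.symm.trans ((congrArg (toModel x₀ _) (hγ _ hyW)).trans (Θ.toModel_sharp hy _))

end Bivector

end Involutive

/-! ### The leaf forms, and density of the nonsingular locus. -/

section Leaves

open Set Module

variable {E : Type*} [NormedAddCommGroup E] [NormedSpace ℝ E] [FiniteDimensional ℝ E]
  {M : Type*} [TopologicalSpace M] [ChartedSpace E M] [IsManifold 𝓘(ℝ, E) ∞ M]

namespace Bivector

variable (Θ : Bivector E M)

theorem imageForm_isAlt (x : M) : (Θ.imageForm x).IsAlt := by
  rintro ⟨_, v, rfl⟩
  rw [imageForm_sharp]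
  have := Θ.apply_sharp_add x v v
  simp only
  linarith

/-- If v(Θw) = 0 for all `w`, then w(Θv) = 0 for all `w` by skewness, so Θv = 0. -/
theorem imageForm_nondegenerate (x : M) : (Θ.imageForm x).Nondegenerate := by
  rw [(Θ.imageForm_isAlt x).isRefl.nondegenerate_iff_separatingLeft]
  rintro ⟨_, v, rfl⟩ h
  rw [← Subtype.coe_inj]
  change Θ.sharp x v = 0
  have : SeparatingDual ℝ (Tangent E x) := inferInstanceAs (SeparatingDual ℝ E)
  refine SeparatingDual.eq_zero_of_forall_dual_eq_zero (R := ℝ) fun w ↦ ?_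
  have h1 := h ⟨Θ.sharp x w, LinearMap.mem_range_self _ w⟩
  rw [imageForm_sharp] at h1
  have := Θ.apply_sharp_add x v w
  simp only at h1
  linarith

variable {Θ} {L : Set M} {k : ℕ} {U : Set (EuclideanSpace ℝ (Fin k))}
  {c : EuclideanSpace ℝ (Fin k) → M} {x₀ : M} {u : EuclideanSpace ℝ (Fin k)}

namespace IsLeafParametrization

theorem contMDiffAt (hc : Θ.IsLeafParametrization L U c) (hu : u ∈ U) :
    ContMDiffAt 𝓘(ℝ, EuclideanSpace ℝ (Fin k)) 𝓘(ℝ, E) ∞ c u :=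
  hc.smooth.contMDiffAt (hc.isOpen.mem_nhds hu)

theorem contDiffAt_extChartAt_comp (hc : Θ.IsLeafParametrization L U c) (hu : u ∈ U)
    (hy : c u ∈ (chartAt E x₀).source) : ContDiffAt ℝ ∞ (extChartAt 𝓘(ℝ, E) x₀ ∘ c) u :=
  ((contMDiffOn_extChartAt.contMDiffAt ((chartAt E x₀).open_source.mem_nhds hy)).comp u
    (hc.contMDiffAt hu)).contDiffAt

theorem fderiv_extChartAt_comp (hc : Θ.IsLeafParametrization L U c) (hu : u ∈ U)
    (hy : c u ∈ (chartAt E x₀).source) (ξ : EuclideanSpace ℝ (Fin k)) :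
    fderiv ℝ (extChartAt 𝓘(ℝ, E) x₀ ∘ c) u ξ =
      toModel x₀ (c u) (mfderiv 𝓘(ℝ, EuclideanSpace ℝ (Fin k)) 𝓘(ℝ, E) c u ξ) := by
  have h1 := mfderiv_comp u ((contMDiffOn_extChartAt (I := 𝓘(ℝ, E)) (n := ∞)).contMDiffAt
    ((chartAt E x₀).open_source.mem_nhds hy) |>.mdifferentiableAt (by simp))
    ((hc.contMDiffAt hu).mdifferentiableAt (by simp))
  rw [← toModel_eq_mfderiv hy, mfderiv_eq_fderiv] at h1
  exact congrArg (fun D : EuclideanSpace ℝ (Fin k) →L[ℝ] E ↦ D ξ) h1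

theorem injective_fderiv (hc : Θ.IsLeafParametrization L U c) (hu : u ∈ U)
    (hy : c u ∈ (chartAt E x₀).source) :
    Function.Injective (fderiv ℝ (extChartAt 𝓘(ℝ, E) x₀ ∘ c) u) := by
  intro ξ η h
  rw [hc.fderiv_extChartAt_comp hu hy, hc.fderiv_extChartAt_comp hu hy] at h
  exact hc.immersion u hu (Function.LeftInverse.injective (ofModel_toModel hy) h)

theorem exists_fderiv_eq (hc : Θ.IsLeafParametrization L U c) (hu : u ∈ U)
    (hy : c u ∈ (chartAt E x₀).source) (a : E →L[ℝ] ℝ) :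
    ∃ ξ, fderiv ℝ (extChartAt 𝓘(ℝ, E) x₀ ∘ c) u ξ =
      Θ.localSharp x₀ ((extChartAt 𝓘(ℝ, E) x₀ ∘ c) u) a := by
  have h1 : Θ.sharp (c u) (covector x₀ (c u) a) ∈ Θ.image (c u) := LinearMap.mem_range_self _ _
  rw [← hc.tangent u hu] at h1
  obtain ⟨ξ, hξ⟩ := h1
  refine ⟨ξ, (hc.fderiv_extChartAt_comp hu hy ξ).trans ?_⟩
  rw [Function.comp_apply, Θ.localSharp_extChartAt hy,
    sharpAt_apply]
  exact congrArg (toModel x₀ (c u)) hξ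

theorem exists_eq_fderiv (hc : Θ.IsLeafParametrization L U c) (hu : u ∈ U)
    (hy : c u ∈ (chartAt E x₀).source) (ξ : EuclideanSpace ℝ (Fin k)) :
    ∃ a, Θ.localSharp x₀ ((extChartAt 𝓘(ℝ, E) x₀ ∘ c) u) a =
      fderiv ℝ (extChartAt 𝓘(ℝ, E) x₀ ∘ c) u ξ := by
  have h1 := (Θ.map_image hy _).1 (hc.differential ⟨u, hu⟩ ξ).2
  obtain ⟨a, ha⟩ := h1
  refine ⟨a, ?_⟩
  rw [hc.fderiv_extChartAt_comp hu hy, Function.comp_apply, Θ.localSharp_extChartAt hy, ha]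
  rfl

theorem eventually (hc : Θ.IsLeafParametrization L U c) (hu : u ∈ U)
    (hy : c u ∈ (chartAt E x₀).source) : ∀ᶠ v in 𝓝 u, v ∈ U ∧ c v ∈ (chartAt E x₀).source :=
  (hc.isOpen.mem_nhds hu |> Filter.eventually_mem_set.2).and
    ((hc.contMDiffAt hu).continuousAt.eventually ((chartAt E x₀).open_source.mem_nhds hy))

/-- In a chart, the form on a leaf corresponds to the bivector field. -/
theorem isLeafForm (hc : Θ.IsLeafParametrization L U c) (hu : u ∈ U)
    (hy : c u ∈ (chartAt E x₀).source)
    {σ : EuclideanSpace ℝ (Fin k) → EuclideanSpace ℝ (Fin k) [⋀^Fin 2]→L[ℝ] ℝ}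
    (hσ : ∀ ξ η, σ u ![ξ, η] =
      Θ.imageForm (c u) (hc.differential ⟨u, hu⟩ ξ) (hc.differential ⟨u, hu⟩ η)) :
    IsLeafForm (Θ.localSharp x₀) (extChartAt 𝓘(ℝ, E) x₀ ∘ c) σ u := by
  intro a ξ η h
  rw [hc.fderiv_extChartAt_comp hu hy, Function.comp_apply, Θ.localSharp_extChartAt hy,
    sharpAt_apply] at h
  have h1 := Function.LeftInverse.injective (ofModel_toModel hy) h
  have h2 : hc.differential ⟨u, hu⟩ ξ =
      ⟨Θ.sharp (c u) (covector x₀ (c u) a), LinearMap.mem_range_self _ _⟩ := Subtype.ext h1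
  rw [hσ, h2, imageForm_sharp, hc.fderiv_extChartAt_comp hu hy]
  rfl

end IsLeafParametrization

open Classical in
/-- The two-form on the domain of a leaf parametrization given by the forms on the images. -/
def IsLeafParametrization.form (hc : Θ.IsLeafParametrization L U c)
    (u : EuclideanSpace ℝ (Fin k)) : EuclideanSpace ℝ (Fin k) [⋀^Fin 2]→L[ℝ] ℝ :=
  if hu : u ∈ U then
    alternatize _ (LinearMap.toContinuousLinearMap (LinearMap.toContinuousLinearMap.toLinearMap ∘ₗ
      (Θ.imageForm (c u)).compl₁₂ (hc.differential ⟨u, hu⟩) (hc.differential ⟨u, hu⟩)))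
  else 0

theorem IsLeafParametrization.form_apply (hc : Θ.IsLeafParametrization L U c) (hu : u ∈ U)
    (ξ η : EuclideanSpace ℝ (Fin k)) : hc.form u ![ξ, η] =
      Θ.imageForm (c u) (hc.differential ⟨u, hu⟩ ξ) (hc.differential ⟨u, hu⟩ η) := by
  rw [form, dif_pos hu, alternatize_apply_of_skew]
  · rfl
  · intro ξ η
    exact ((Θ.imageForm_isAlt (c u)).neg _ _).symm

/-- Every vector tangent to the parametrization comes from a covector, so each value of the exterior
derivative is a value of the Jacobiator. -/
theorem leafFormIsSymplectic_of_jacobiator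
    (hJ : ∀ x₀ : M, ∀ z ∈ (extChartAt 𝓘(ℝ, E) x₀).target, ∀ a b c,
      jacobiator (Θ.localSharp x₀) z a b c = 0) (L : Set M) : Θ.LeafFormIsSymplectic L := by
  refine ⟨fun y _ ↦ ⟨Θ.imageForm_isAlt y, Θ.imageForm_nondegenerate y⟩,
    fun k U c hc ↦ ⟨hc.form, ?_, fun u ξ η ↦ hc.form_apply u.2 ξ η, ?_⟩⟩
  all_goals
    intro u hu
    have hy : c u ∈ (chartAt E (c u)).source := mem_chart_source E (c u)
    have hz : (extChartAt 𝓘(ℝ, E) (c u) ∘ c) u ∈ (extChartAt 𝓘(ℝ, E) (c u)).target :=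
      mem_extChartAt_target (c u)
    have hev := hc.eventually hu hy
    have hform : ∀ᶠ v in 𝓝 u, IsLeafForm (Θ.localSharp (c u))
        (extChartAt 𝓘(ℝ, E) (c u) ∘ c) hc.form v :=
      hev.mono fun v hv ↦ hc.isLeafForm hv.1 hv.2 (hc.form_apply hv.1)
    have hσ := IsLeafForm.contDiffAt (Θ.contDiffAt_localSharp hz)
      (hc.contDiffAt_extChartAt_comp hu hy) (hc.injective_fderiv hu hy)
      (hev.mono fun v hv ↦ hc.exists_fderiv_eq hv.1 hv.2) (hc.exists_eq_fderiv hu hy) hform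
  · exact hσ.contDiffWithinAt
  · ext v
    obtain ⟨a, ha⟩ := hc.exists_eq_fderiv hu hy (v 0)
    obtain ⟨b, hb⟩ := hc.exists_eq_fderiv hu hy (v 1)
    obtain ⟨w, hw⟩ := hc.exists_eq_fderiv hu hy (v 2)
    have h := IsLeafForm.extDeriv_eq (.of_forall fun w ↦ Θ.localSharp_skew (c u) w)
      (Θ.contDiffAt_localSharp hz)
      (hc.contDiffAt_extChartAt_comp hu hy) (hc.injective_fderiv hu hy)
      (hev.mono fun v hv ↦ hc.exists_fderiv_eq hv.1 hv.2) (hσ.differentiableAt (by simp)) hform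
      ha.symm hb.symm hw.symm
    rw [hJ _ _ hz] at h
    refine Eq.trans ?_ h
    refine congrArg (extDeriv hc.form u) ?_
    ext i
    fin_cases i <;> rfl

/-- Conversely, every Qa is tangent to the parametrization, so the Jacobiator on any three covectors
is a value of the exterior derivative. -/
theorem LeafFormIsSymplectic.jacobiator_eq_zero (hL : Θ.LeafFormIsSymplectic L)
    (hc : Θ.IsLeafParametrization L U c) (hu : u ∈ U) (hy : c u ∈ (chartAt E x₀).source)
    (a b w : E →L[ℝ] ℝ) :
    jacobiator (Θ.localSharp x₀) (extChartAt 𝓘(ℝ, E) x₀ (c u)) a b w = 0 := by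
  obtain ⟨σ, hσ, hform, hd⟩ := hL.2 k U c hc
  have hev := hc.eventually hu hy
  have hz : extChartAt 𝓘(ℝ, E) x₀ (c u) ∈ (extChartAt 𝓘(ℝ, E) x₀).target :=
    (extChartAt 𝓘(ℝ, E) x₀).map_source (by rwa [extChartAt_source])
  obtain ⟨ξ, hξ⟩ := hc.exists_fderiv_eq hu hy a
  obtain ⟨η, hη⟩ := hc.exists_fderiv_eq hu hy b
  obtain ⟨ζ, hζ⟩ := hc.exists_fderiv_eq hu hy w
  have h := IsLeafForm.extDeriv_eq (c := extChartAt 𝓘(ℝ, E) x₀ ∘ c)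
    (.of_forall fun w ↦ Θ.localSharp_skew x₀ w) (Θ.contDiffAt_localSharp hz)
    (hc.contDiffAt_extChartAt_comp hu hy) (hc.injective_fderiv hu hy)
    (hev.mono fun v hv ↦ hc.exists_fderiv_eq hv.1 hv.2)
    ((hσ.contDiffAt (hc.isOpen.mem_nhds hu)).differentiableAt (by simp))
    (hev.mono fun v hv ↦ hc.isLeafForm hv.1 hv.2 (hform ⟨v, hv.1⟩)) hξ hη hζ
  rw [hd u hu] at h
  exact h.symm

variable (Θ)

theorem eventually_finrank_image_le (x : M) :
    ∀ᶠ y in 𝓝 x, finrank ℝ (Θ.image x) ≤ finrank ℝ (Θ.image y) := by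
  have hx : x ∈ (chartAt E x).source := mem_chart_source E x
  have h1 := eventually_le_finrank_range
    (Θ.contDiffAt_localSharp (mem_extChartAt_target (I := 𝓘(ℝ, E)) x)).continuousAt
  filter_upwards [(continuousAt_extChartAt (I := 𝓘(ℝ, E)) x).eventually h1,
    (chartAt E x).open_source.mem_nhds hx] with y h2 h3
  rwa [Θ.localSharp_extChartAt hx, Θ.localSharp_extChartAt h3, ← Θ.finrank_image hx,
    ← Θ.finrank_image h3] at h2

theorem isOpen_nonsingularLocus : IsOpen Θ.nonsingularLocus := by
  rw [isOpen_iff_mem_nhds]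
  intro x hx
  have hx : ∀ᶠ y in 𝓝 x, finrank ℝ (Θ.image y) = finrank ℝ (Θ.image x) := hx
  filter_upwards [hx, hx.eventually_nhds] with y h1 h2
  exact h2.mono fun w hw ↦ hw.trans h1.symm

/-- The rank is bounded by dim `E`, so it attains a maximum on any nonempty open set; by
semicontinuity it is constant near a maximum point. -/
theorem dense_nonsingularLocus : Dense Θ.nonsingularLocus := by
  intro x
  rw [mem_closure_iff]
  intro W hW hxW
  have hbdd : BddAbove ((fun y ↦ finrank ℝ (Θ.image y)) '' W) := by
    refine ⟨finrank ℝ E, ?_⟩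
    rintro _ ⟨y, -, rfl⟩
    exact Submodule.finrank_le (Θ.image y)
  obtain ⟨y, hyW, hy⟩ := Nat.sSup_mem (Set.Nonempty.image _ ⟨x, hxW⟩) hbdd
  refine ⟨y, hyW, ?_⟩
  filter_upwards [Θ.eventually_finrank_image_le y, hW.mem_nhds hyW] with w h1 h2
  refine le_antisymm ?_ h1
  have := le_csSup hbdd (mem_image_of_mem _ h2)
  rwa [← hy] at this

end Bivector

end Leaves

/-! ### Leaves through nonsingular points, and the equivalence. -/

section Integrability

open Set Module

variable {E : Type*} [NormedAddCommGroup E] [NormedSpace ℝ E]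
  {M : Type*} [TopologicalSpace M] [ChartedSpace E M] [IsManifold 𝓘(ℝ, E) ∞ M]

variable {x₀ : M} {k : ℕ} {c : EuclideanSpace ℝ (Fin k) → E}

theorem mfderiv_extChartAt_symm_comp {s : EuclideanSpace ℝ (Fin k)}
    (hz : c s ∈ (extChartAt 𝓘(ℝ, E) x₀).target) (hc : DifferentiableAt ℝ c s) :
    mfderiv 𝓘(ℝ, EuclideanSpace ℝ (Fin k)) 𝓘(ℝ, E) ((extChartAt 𝓘(ℝ, E) x₀).symm ∘ c) s =
      ofModel x₀ ((extChartAt 𝓘(ℝ, E) x₀).symm (c s)) ∘L fderiv ℝ c s := by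
  rw [mfderiv_comp s ((contMDiffAt_extChartAt_symm_of_mem hz).mdifferentiableAt (by simp))
    hc.mdifferentiableAt, ← ofModel_eq_mfderiv hz, mfderiv_eq_fderiv]
  rfl

variable [FiniteDimensional ℝ E]

namespace Bivector

variable {Θ : Bivector E M} {δ : ℝ}

theorem range_mfderiv_extChartAt_symm_comp {s : EuclideanSpace ℝ (Fin k)}
    (hz : c s ∈ (extChartAt 𝓘(ℝ, E) x₀).target) (hc : DifferentiableAt ℝ c s)
    (h : (fderiv ℝ c s).toLinearMap.range = (Θ.localSharp x₀ (c s)).toLinearMap.range) :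
    LinearMap.range (mfderiv 𝓘(ℝ, EuclideanSpace ℝ (Fin k)) 𝓘(ℝ, E)
      ((extChartAt 𝓘(ℝ, E) x₀).symm ∘ c) s).toLinearMap =
      Θ.image ((extChartAt 𝓘(ℝ, E) x₀).symm (c s)) := by
  have hy := symm_mem_chart_source hz
  rw [mfderiv_extChartAt_symm_comp hz hc]
  ext v
  refine Iff.trans ?_ (Θ.map_image hy v).symm
  have h1 : (∃ a, Θ.sharpAt x₀ ((extChartAt 𝓘(ℝ, E) x₀).symm (c s)) a =
        toModel x₀ ((extChartAt 𝓘(ℝ, E) x₀).symm (c s)) v) ↔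
      toModel x₀ ((extChartAt 𝓘(ℝ, E) x₀).symm (c s)) v ∈ (fderiv ℝ c s).toLinearMap.range := by
    rw [h]
    rfl
  rw [h1]
  constructor
  · rintro ⟨ξ, rfl⟩
    exact ⟨ξ, (toModel_ofModel hy _).symm⟩
  · rintro ⟨ξ, hξ⟩
    refine ⟨ξ, ?_⟩
    refine (congrArg (ofModel x₀ _) hξ).trans (ofModel_toModel hy v)

/-- An integral immersion in a chart, with values in the nonsingular locus, parametrizes an open
piece of a leaf. -/
theorem isLeafParametrization_extChartAt_symm_comp
    (hmaps : MapsTo c (Metric.ball 0 δ) (extChartAt 𝓘(ℝ, E) x₀).target)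
    (hns : ∀ s ∈ Metric.ball (0 : EuclideanSpace ℝ (Fin k)) δ,
      (extChartAt 𝓘(ℝ, E) x₀).symm (c s) ∈ Θ.nonsingularLocus)
    (hc : ContDiffOn ℝ ∞ c (Metric.ball 0 δ)) (hinj : InjOn c (Metric.ball 0 δ))
    (hd : ∀ s ∈ Metric.ball 0 δ, Function.Injective (fderiv ℝ c s) ∧
      (fderiv ℝ c s).toLinearMap.range = (Θ.localSharp x₀ (c s)).toLinearMap.range) :
    Θ.IsLeafParametrization (Θ.leafThrough ((extChartAt 𝓘(ℝ, E) x₀).symm (c 0)))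
      (Metric.ball 0 δ) ((extChartAt 𝓘(ℝ, E) x₀).symm ∘ c) := by
  have hdiff (s) (hs : s ∈ Metric.ball (0 : EuclideanSpace ℝ (Fin k)) δ) :
      ContDiffAt ℝ ∞ c s := hc.contDiffAt (Metric.isOpen_ball.mem_nhds hs)
  have hdiff' (s) (hs : s ∈ Metric.ball (0 : EuclideanSpace ℝ (Fin k)) δ) :
      DifferentiableAt ℝ c s := (hdiff s hs).differentiableAt (by simp)
  have hsm (s) (hs : s ∈ Metric.ball (0 : EuclideanSpace ℝ (Fin k)) δ) :
      ContMDiffAt 𝓘(ℝ, EuclideanSpace ℝ (Fin k)) 𝓘(ℝ, E) ∞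
        ((extChartAt 𝓘(ℝ, E) x₀).symm ∘ c) s :=
    (contMDiffAt_extChartAt_symm_of_mem (hmaps hs)).comp s (hdiff s hs).contMDiffAt
  have htan (s) (hs : s ∈ Metric.ball (0 : EuclideanSpace ℝ (Fin k)) δ) :=
    range_mfderiv_extChartAt_symm_comp (hmaps hs) (hdiff' s hs) (hd s hs).2
  refine ⟨Metric.isOpen_ball, fun s hs ↦ (hsm s hs).contMDiffWithinAt, ?_, ?_, ?_, htan⟩
  · exact fun s hs t ht h ↦ hinj hs ht ((extChartAt 𝓘(ℝ, E) x₀).symm.injOn (hmaps hs) (hmaps ht) h)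
  · intro s hs
    -- The image of a radial segment joins c(0) to c(s). The smooth transition function
    -- reparametrizes it as a curve on all of ℝ, as tangent curves require, without leaving the
    -- ball.
    refine Relation.ReflTransGen.single
      ⟨fun t ↦ ((extChartAt 𝓘(ℝ, E) x₀).symm ∘ c) (Real.smoothTransition t • s), ?_, ?_, ?_,
        ⟨0, by simp⟩, ⟨1, by simp⟩⟩
    all_goals
      have hball (t : ℝ) : Real.smoothTransition t • s ∈ Metric.ball 0 δ := by
        rw [mem_ball_zero_iff] at hs ⊢
        rw [norm_smul, Real.norm_of_nonneg (Real.smoothTransition.nonneg t)]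
        exact (mul_le_of_le_one_left (norm_nonneg s) (Real.smoothTransition.le_one t)).trans_lt hs
      have hline (t : ℝ) : ContMDiffAt 𝓘(ℝ, ℝ) 𝓘(ℝ, EuclideanSpace ℝ (Fin k)) ∞
          (fun t ↦ Real.smoothTransition t • s) t :=
        (Real.smoothTransition.contDiff.smul contDiff_const).contMDiff t
    · exact fun t ↦ ContMDiffAt.comp (g := (extChartAt 𝓘(ℝ, E) x₀).symm ∘ c) t
        (hsm _ (hball t)) (hline t)
    · exact fun t ↦ hns _ (hball t)
    · intro t
      refine le_trans ?_ (htan _ (hball t)).le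
      have h1 := mfderiv_comp t ((hsm _ (hball t)).mdifferentiableAt (by simp))
        ((hline t).mdifferentiableAt (by simp))
      rintro _ ⟨v, rfl⟩
      exact ⟨_, (congrArg (fun D : ℝ →L[ℝ] E ↦ D v) h1).symm⟩
  · intro s hs
    rw [mfderiv_extChartAt_symm_comp (hmaps hs) (hdiff' s hs)]
    exact (Function.LeftInverse.injective (toModel_ofModel (symm_mem_chart_source (hmaps hs)))).comp
      (hd s hs).1

/-- Constant rank and involutivity produce a leaf parametrization through the point, and the
symplectic condition is applied to the leaf containing it. -/
theorem jacobiator_eq_zero_of_mem_nonsingularLocus (hΘ : Θ.ImageClosedUnderLieBracket)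
    (hL : ∀ L, Θ.IsLeaf L → Θ.LeafFormIsSymplectic L) {z : E}
    (hz : z ∈ (extChartAt 𝓘(ℝ, E) x₀).target)
    (hns : (extChartAt 𝓘(ℝ, E) x₀).symm z ∈ Θ.nonsingularLocus) (a b w : E →L[ℝ] ℝ) :
    jacobiator (Θ.localSharp x₀) z a b w = 0 := by
  obtain ⟨N, hN, hNo, hzN⟩ := eventually_nhds_iff.1
    ((show ∀ᶠ y in 𝓝 _, _ from hns).and (Θ.isOpen_nonsingularLocus.mem_nhds hns))
  set S : Set E := (extChartAt 𝓘(ℝ, E) x₀).target ∩ (extChartAt 𝓘(ℝ, E) x₀).symm ⁻¹' N with hS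
  have hSo : IsOpen S :=
    (continuousOn_extChartAt_symm x₀).isOpen_inter_preimage (isOpen_extChartAt_target x₀) hNo
  obtain ⟨δ, hδ, c, hc0, hmaps, hc, hinj, hd⟩ := exists_integral_immersion hSo
    ((Θ.contDiffOn_localSharp x₀).mono inter_subset_left)
    (k := finrank ℝ (Θ.image ((extChartAt 𝓘(ℝ, E) x₀).symm z)))
    (fun w hw ↦ by
      rw [← (hN _ hw.2).1, Θ.finrank_image (symm_mem_chart_source hw.1)]
      rfl)
    (fun w hw ↦ hΘ.exists_eq hw.1) ⟨hz, hzN⟩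
  have hpar := isLeafParametrization_extChartAt_symm_comp (Θ := Θ) (fun s hs ↦ (hmaps hs).1)
    (fun s hs ↦ (hN _ (hmaps hs).2).2) hc hinj hd
  rw [hc0] at hpar
  have h := (hL _ ⟨_, hns, rfl⟩).jacobiator_eq_zero (x₀ := x₀) hpar (Metric.mem_ball_self hδ)
    (by rw [Function.comp_apply, hc0]; exact symm_mem_chart_source hz) a b w
  rwa [Function.comp_apply, hc0, (extChartAt 𝓘(ℝ, E) x₀).right_inv hz] at h

/-- A nonzero value would persist on a neighborhood by continuity, and that neighborhood contains
nonsingular points. -/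
theorem jacobiator_eq_zero (hΘ : Θ.ImageClosedUnderLieBracket)
    (hL : ∀ L, Θ.IsLeaf L → Θ.LeafFormIsSymplectic L) {z : E}
    (hz : z ∈ (extChartAt 𝓘(ℝ, E) x₀).target) (a b w : E →L[ℝ] ℝ) :
    jacobiator (Θ.localSharp x₀) z a b w = 0 := by
  by_contra hne
  have hs := Θ.contDiffAt_localSharp hz
  have hs' := (hs.fderiv_right (m := ∞) (by simp)).continuousAt
  have hterm (a b w : E →L[ℝ] ℝ) : ContinuousAt
      (fun z ↦ w (fderiv ℝ (Θ.localSharp x₀) z (Θ.localSharp x₀ z a) b)) z :=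
    w.continuous.continuousAt.comp
      ((hs'.clm_apply (hs.continuousAt.clm_apply continuousAt_const)).clm_apply continuousAt_const)
  have hJ : ContinuousAt (fun z ↦ jacobiator (Θ.localSharp x₀) z a b w) z :=
    ((hterm a b w).add (hterm b w a)).add (hterm w a b)
  have hy := symm_mem_chart_source hz
  have hφ : ContinuousAt (extChartAt 𝓘(ℝ, E) x₀) ((extChartAt 𝓘(ℝ, E) x₀).symm z) :=
    continuousAt_extChartAt' (by rwa [extChartAt_source])
  have hev := hJ.eventually_ne hne
  rw [← (extChartAt 𝓘(ℝ, E) x₀).right_inv hz] at hev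
  obtain ⟨y, hyns, h1, h2⟩ := Θ.dense_nonsingularLocus.inter_nhds_nonempty
    (Filter.inter_mem (hφ.eventually hev) ((chartAt E x₀).open_source.mem_nhds hy))
  have h2' : y ∈ (extChartAt 𝓘(ℝ, E) x₀).source := by rwa [extChartAt_source]
  refine h1 (jacobiator_eq_zero_of_mem_nonsingularLocus hΘ hL
    ((extChartAt 𝓘(ℝ, E) x₀).map_source h2') ?_ a b w)
  rwa [(extChartAt 𝓘(ℝ, E) x₀).left_inv h2']

/-- A bivector field is Poisson if and only if its image is closed under the Lie bracket and the
induced forms on the leaves of its nonsingular locus are symplectic. -/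
theorem isPoisson_iff [T2Space M] : Θ.IsPoisson ↔
    Θ.ImageClosedUnderLieBracket ∧ ∀ L : Set M, Θ.IsLeaf L → Θ.LeafFormIsSymplectic L := by
  rw [isPoisson_iff_jacobiator]
  exact ⟨fun h ↦ ⟨Θ.imageClosedUnderLieBracket_of_jacobiator h,
    fun L _ ↦ leafFormIsSymplectic_of_jacobiator h L⟩,
    fun h x₀ z hz ↦ jacobiator_eq_zero h.1 h.2 hz⟩

end Bivector

end Integrability

end PoissonGeometry

end

/-- A smooth bivector field `Θ` on a manifold `M` is Poisson if and only if the image subsheaf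
`Θ(T*M)` of `TM` is closed under the Lie bracket and, on each leaf of the nonsingular locus,
the induced two-form is symplectic. -/
theorem proposition1 {E : Type*} [NormedAddCommGroup E] [NormedSpace ℝ E] [FiniteDimensional ℝ E]
    {M : Type*} [TopologicalSpace M] [T2Space M] [SecondCountableTopology M]
    [ChartedSpace E M] [IsManifold 𝓘(ℝ, E) ∞ M] (Θ : PoissonGeometry.Bivector E M) :
    Θ.IsPoisson ↔
      Θ.ImageClosedUnderLieBracket ∧
        ∀ L : Set M, Θ.IsLeaf L → Θ.LeafFormIsSymplectic L :=
  Θ.isPoisson_iff
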